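/- Let $m\ge 1$ and let $T_1,\dots,T_m$ be locally finite simplicial trees with height functions $h_i\colon T_i\to\mathbb R$, that is, functions that are affine on each edge. Suppose that for every $i$: 1. $h_i$ maps the vertices of $T_i$ to a closed discrete subset of $\mathbb R$ (every bounded interval contains only finitely many heights of vertices); 2. there is exactly one descending end in $T_i$: every vertex has a neighbour of strictly smaller height, so that descending edge paths never stop, and any two infinite edge paths along which the height strictly decreases eventually coincide (up to a shift of the parametrization); 3. each vertex of $T_i$ has degree $\ge 3$. Let $T:=T_1\times\cdots\times T_m$, let $h\colon T\to\mathbb R$ be given by $h(x_1,\dots,x_m)=\sum_{i=1}^m h_i(x_i)$, and put $T_I:=h^{-1}(I)$ for every nonempty compact interval $I\subset\mathbb R$. Then for each nonempty compact interval $I$ the space $T_I$ is $(m-2)$-connected, i.e. it is nonempty and its homotopy groups $\pi_i(T_I)$ are trivial for $0\le i\le m-2$ and every base point. Moreover, for any two nonempty compact intervals $I\subseteq J$, the inclusion $T_I\hookrightarrow T_J$ induces a non-trivial (i.e. nonzero) map $\tilde H_{m-1}(T_I)\to\tilde H_{m-1}(T_J)$ in reduced singular homology with integer coefficients. -/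

import Mathlib

open CategoryTheory CategoryTheory.Limits
open scoped Topology

universe u

noncomputable section

/-- The set of points of the geometric realization of a graph `G`, in barycentric coordinates:
the point with coordinates `x : V → ℝ` lies on the segment spanned by two adjacent vertices,
or is itself a vertex. The vertex `v` is the unit vector `Pi.single v 1`. -/
def realizationSet {V : Type u} (G : SimpleGraph V) : Set (V → ℝ) :=
  open Classical in
  {x | ∃ v w : V, (v = w ∨ G.Adj v w) ∧
    x ∈ segment ℝ (Pi.single v (1 : ℝ) : V → ℝ) (Pi.single w (1 : ℝ))}

/-- The geometric realization of a graph, with the topology of pointwise convergence of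
barycentric coordinates. On a locally finite graph this is the usual (weak, equivalently metric)
topology of the associated one-dimensional complex. -/
abbrev Realization {V : Type u} (G : SimpleGraph V) : Type u := realizationSet G

/-- The extension of a function on the vertices to the geometric realization that is affine on
each edge: `(1 - t) v + t w` is mapped to `(1 - t) h v + t h w`. Points of the realization have
at most two nonzero coordinates, so the sum is finite. -/
def affineHeight {V : Type u} {G : SimpleGraph V} (h : V → ℝ) (x : Realization G) : ℝ :=
  ∑ᶠ v, x.1 v * h v

/-- An infinite edge path along which the height strictly decreases. -/
def IsDescendingRay {V : Type u} (G : SimpleGraph V) (h : V → ℝ) (p : ℕ → V) : Prop :=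
  ∀ n, G.Adj (p n) (p (n + 1)) ∧ h (p (n + 1)) < h (p n)

/-- There is exactly one descending end: a descending path can always be continued, and any two
infinite descending paths eventually coincide, up to a shift of the parametrization. -/
structure HasUniqueDescendingEnd {V : Type u} (G : SimpleGraph V) (h : V → ℝ) : Prop where
  exists_lower : ∀ v, ∃ w, G.Adj v w ∧ h w < h v
  eventually_eq : ∀ p q : ℕ → V, IsDescendingRay G h p → IsDescendingRay G h q →
    ∃ k l : ℕ, ∀ n, p (k + n) = q (l + n)

/-- The preimage of `I` under the summed height on the product of the realizations. -/
def heightPreimage {m : ℕ} {V : Fin m → Type u} (G : ∀ i, SimpleGraph (V i))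
    (h : ∀ i, V i → ℝ) (I : Set ℝ) : Set (∀ i, Realization (G i)) :=
  {x | ∑ i, affineHeight (h i) (x i) ∈ I}

/-- The inclusion of the preimage of `I` into the preimage of a larger set `J`. -/
def heightPreimageInclusion {m : ℕ} {V : Fin m → Type u} (G : ∀ i, SimpleGraph (V i))
    (h : ∀ i, V i → ℝ) {I J : Set ℝ} (hIJ : I ⊆ J) :
    TopCat.of (heightPreimage G h I) ⟶ TopCat.of (heightPreimage G h J) :=
  TopCat.ofHom ⟨Set.inclusion (fun _ hx => hIJ hx), continuous_inclusion _⟩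

/-- `n`-connectedness for an integer `n`: all homotopy groups (pointed sets for `i = 0`) in
degrees `0 ≤ i ≤ n` are trivial for every base point, and the space is nonempty if `n ≥ -1`. -/
def IsHomotopyConnected (n : ℤ) (X : Type u) [TopologicalSpace X] : Prop :=
  (-1 ≤ n → Nonempty X) ∧ ∀ i : ℕ, (i : ℤ) ≤ n → ∀ x : X, Subsingleton (π_ i X x)

/-- Singular homology with integer coefficients in degree `n`. -/
def integralHomology (n : ℕ) : TopCat.{u} ⥤ ModuleCat.{u} ℤ :=
  (AlgebraicTopology.singularHomologyFunctor (ModuleCat.{u} ℤ) n).obj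
    (ModuleCat.of ℤ (ULift.{u} ℤ))

/-- The map from a space to the one-point space. -/
def toPoint (X : TopCat.{u}) : X ⟶ TopCat.of PUnit.{u + 1} :=
  TopCat.ofHom (ContinuousMap.const X PUnit.unit)

/-- Reduced singular homology with integer coefficients in degree `n ≥ 0`: the kernel of the map
to the homology of a point. -/
def reducedHomology (n : ℕ) (X : TopCat.{u}) : ModuleCat.{u} ℤ :=
  kernel ((integralHomology n).map (toPoint X))

/-- The map induced by a continuous map on reduced homology. -/
def reducedHomologyMap (n : ℕ) {X Y : TopCat.{u}} (f : X ⟶ Y) :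
    reducedHomology n X ⟶ reducedHomology n Y :=
  kernel.map _ _ ((integralHomology n).map f) (𝟙 _) (by
    rw [Category.comp_id, ← Functor.map_comp]
    rfl)

end

/-! Every edge joins a vertex to its unique lower neighbour, so each tree is given by a parent map.
Two points have a highest common ancestor, whose height is `meet`, and the geodesic between them
descends to that height and climbs again. All later arguments use only the operations collected in
`MergeTree`.

Connectivity. A map from the boundary of a d-dimensional cube, d < m, into the superlevel set h ≥ a
first extends to a map F into the whole product, which is contractible. F is then pushed upwards:
ℝ^d is divided into cubes by m shifted grids, one for each tree, and over a cube of the i-th grid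
the i-th coordinate travels along a geodesic to a very high point, except near the walls. As d < m,
every point is far from the walls of some grid (`exists_cubeBump_eq_one`); the coordinate of that
grid arrives and outweighs the others, which are bounded below on a compact ball. Over the given
sphere no height may be lost at all; there the points are first lifted by `rise`
(`eventually_le_sum_meet_rise`). This fills the sphere above level a
(`exists_extension_superlevel`), and lowering all coordinates equally brings the filling below b
(`exists_extension_slab`), since descending is always possible.

Nontriviality. In each tree take a vertex v i from which two branches ascend, low enough that the
total height of v lies below J. The lines through the v i span a flat on which the height is a
constant plus the sum of the |s i|, so level a contains a sphere around v. The boundary of a simplex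
parametrizes it and gives a cycle that bounds in T. Color T_J with m + 1 colors by the largest of 0
and the signed distances from the v i. A point where all colors tie has the height of v, so T_J
contains none. Hence, in fine subdivisions of a singular simplex, no small simplex has all colors,
and counting the small simplices colored 1, …, m is a cocycle on T_J. By Sperner's lemma its value
on the cycle is 1 (`reducedHomologyMap_ne_zero_of_coloring`). -/

noncomputable section

/-! ### The tree as a parent map -/

/-- A tree with a height function and one descending end, encoded by its parent map. -/
structure ParentData {V : Type u} (G : SimpleGraph V) (h : V → ℝ) where
  par : V → V
  adj_iff : ∀ v w, G.Adj v w ↔ par v = w ∨ par w = v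
  par_lt : ∀ v, h (par v) < h v
  merge : ∀ v w, ∃ k l : ℕ, par^[k] v = par^[l] w
  children_finite : ∀ v, {c | par c = v}.Finite
  two_children : ∀ v, ∃ c d, c ≠ d ∧ par c = v ∧ par d = v
  discrete : ∀ a b : ℝ, (Set.range h ∩ Set.Icc a b).Finite

/-- An edge that does not join a vertex to its parent could be deleted without touching any parent
path. The parent paths of its endpoints merge, so it would not be a bridge, against acyclicity. All
neighbours except the parent are therefore children, and degree 3 leaves at least two. -/
theorem exists_parentData {V : Type u} {G : SimpleGraph V} {h : V → ℝ} (htree : G.IsTree)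
    (hfin : ∀ v, (G.neighborSet v).Finite)
    (hdiscrete : ∀ a b : ℝ, (Set.range h ∩ Set.Icc a b).Finite)
    (hend : HasUniqueDescendingEnd G h)
    (hdeg : ∀ v, 3 ≤ (G.neighborSet v).encard) : Nonempty (ParentData G h) := by
  choose par hadj hlt using hend.exists_lower
  have ray (v : V) : IsDescendingRay G h (fun n => par^[n] v) := fun n => by
    simp only [Function.iterate_succ_apply']
    exact ⟨hadj _, hlt _⟩
  have merge (v w : V) : ∃ k l : ℕ, par^[k] v = par^[l] w := by
    obtain ⟨k, l, e⟩ := hend.eventually_eq _ _ (ray v) (ray w)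
    exact ⟨k, l, by simpa using e 0⟩
  have adj (v w : V) : G.Adj v w ↔ par v = w ∨ par w = v := by
    refine ⟨fun e => ?_, ?_⟩
    · by_contra! hne
      have br := SimpleGraph.isAcyclic_iff_forall_adj_isBridge.1 htree.isAcyclic e
      have step (x : V) : (G.deleteEdges {s(v, w)}).Adj x (par x) := by
        rw [SimpleGraph.deleteEdges_adj]
        refine ⟨hadj x, ?_⟩
        rw [Set.mem_singleton_iff, Sym2.eq_iff]
        rintro (⟨rfl, e1⟩ | ⟨rfl, e1⟩)
        · exact hne.1 e1
        · exact hne.2 e1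
      have reach (n : ℕ) (x : V) : (G.deleteEdges {s(v, w)}).Reachable x (par^[n] x) := by
        induction n with
        | zero => exact SimpleGraph.Reachable.refl _
        | succ n ih =>
          rw [Function.iterate_succ_apply']
          exact ih.trans (step _).reachable
      obtain ⟨k, l, ekl⟩ := merge v w
      rw [SimpleGraph.isBridge_iff] at br
      exact br ((reach k v).trans (ekl ▸ (reach l w).symm))
    · rintro (rfl | rfl)
      · exact hadj v
      · exact (hadj w).symm
  have nb (v : V) : G.neighborSet v = insert (par v) {c | par c = v} := by
    ext w
    simp [adj, eq_comm]
  refine ⟨⟨par, adj, hlt, merge, fun v => ?_, fun v => ?_, hdiscrete⟩⟩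
  · exact (hfin v).subset (by rw [nb]; exact Set.subset_insert _ _)
  · have h1 : (1 : ℕ∞) < {c | par c = v}.encard := by
      have := (hdeg v).trans ((nb v).symm ▸ Set.encard_insert_le _ _)
      by_contra! hle
      have h3 : (3 : ℕ∞) ≤ 1 + 1 := this.trans (by gcongr)
      norm_num at h3
    obtain ⟨c, d, hc, hd, hcd⟩ := Set.one_lt_encard_iff.1 h1
    exact ⟨c, d, hcd, hc, hd⟩

namespace ParentData

variable {V : Type u} {G : SimpleGraph V} {h : V → ℝ} (P : ParentData G h)

theorem iterate_le (v : V) (k : ℕ) : h (P.par^[k] v) ≤ h v := by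
  induction k with
  | zero => exact le_rfl
  | succ k ih =>
    rw [Function.iterate_succ_apply']
    exact (P.par_lt _).le.trans ih

theorem iterate_le_par (v : V) {k : ℕ} (hk : k ≠ 0) : h (P.par^[k] v) ≤ h (P.par v) := by
  obtain ⟨k, rfl⟩ := Nat.exists_eq_succ_of_ne_zero hk
  rw [Function.iterate_succ_apply]
  exact P.iterate_le _ _

theorem iterate_injective (v : V) : Function.Injective fun k => P.par^[k] v := by
  have key (k n : ℕ) (hn : n ≠ 0) : P.par^[k] v ≠ P.par^[n + k] v := fun e => by
    have := P.iterate_le_par (P.par^[k] v) hn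
    rw [← Function.iterate_add_apply, ← e] at this
    exact absurd (P.par_lt (P.par^[k] v)) (not_lt.2 this)
  intro k l e
  rcases lt_trichotomy k l with hlt | rfl | hlt
  · exact absurd e (by simpa [Nat.sub_add_cancel hlt.le] using key k (l - k) (by omega))
  · rfl
  · exact absurd e.symm (by simpa [Nat.sub_add_cancel hlt.le] using key l (k - l) (by omega))

theorem exists_iterate_lt (v : V) (r : ℝ) : ∃ k, h (P.par^[k] v) < r := by
  by_contra! hr
  have hinj : Function.Injective fun k => h (P.par^[k] v) := by
    have : StrictAnti fun k => h (P.par^[k] v) := strictAnti_nat_of_succ_lt fun n => by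
      rw [Function.iterate_succ_apply']
      exact P.par_lt _
    exact this.injective
  refine Set.infinite_of_injective_forall_mem hinj (s := Set.range h ∩ Set.Icc r (h v)) ?_
    (P.discrete _ _)
  exact fun n => ⟨⟨_, rfl⟩, hr n, P.iterate_le _ _⟩

/-- If all descendants were below r, their heights would form a finite set; but a highest one still
has a child. -/
theorem exists_descendant (v : V) (r : ℝ) : ∃ w k, P.par^[k] w = v ∧ r ≤ h w := by
  by_contra! hr
  set s : Set ℝ := {t | ∃ w k, P.par^[k] w = v ∧ h w = t}
  have hs : s.Finite := (P.discrete (h v) r).subset (by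
    rintro _ ⟨w, k, hw, rfl⟩
    exact ⟨⟨w, rfl⟩, hw ▸ P.iterate_le w k, (hr w k hw).le⟩)
  obtain ⟨t, ⟨w, k, hw, rfl⟩, hmax⟩ := hs.exists_le_maximal ⟨v, 0, rfl, rfl⟩ |>.imp fun _ h => h.2
  obtain ⟨c, -, -, rfl, -⟩ := P.two_children w
  have := hmax ⟨c, k + 1, hw, rfl⟩ (P.par_lt c).le
  exact absurd this (not_le.2 (P.par_lt c))

end ParentData

/-! ### Points of the realization in edge coordinates -/

namespace ParentData

variable {V : Type u} {G : SimpleGraph V} {h : V → ℝ} (P : ParentData G h)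

/-- The length of the edge below `v`. -/
def len (v : V) : ℝ := h v - h (P.par v)

theorem len_pos (v : V) : 0 < P.len v := sub_pos.2 (P.par_lt v)

theorem par_ne (v : V) : P.par v ≠ v := fun e => (P.par_lt v).ne (congrArg h e)

/-- The point at height `r` on the edge below `v`, in barycentric coordinates. -/
def edgePoint (v : V) (r : ℝ) : V → ℝ :=
  open Classical in fun u =>
    if u = v then (r - h (P.par v)) / P.len v
    else if u = P.par v then 1 - (r - h (P.par v)) / P.len v else 0

theorem edgePoint_self (v : V) (r : ℝ) : P.edgePoint v r v = (r - h (P.par v)) / P.len v := by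
  simp [edgePoint]

theorem edgePoint_par (v : V) (r : ℝ) :
    P.edgePoint v r (P.par v) = 1 - (r - h (P.par v)) / P.len v := by
  simp [edgePoint, P.par_ne]

theorem edgePoint_of_ne {v u : V} (r : ℝ) (h1 : u ≠ v) (h2 : u ≠ P.par v) :
    P.edgePoint v r u = 0 := by
  simp [edgePoint, h1, h2]

open Classical in
theorem edgePoint_eq (v : V) (r : ℝ) : P.edgePoint v r =
    (1 - (r - h (P.par v)) / P.len v) • (Pi.single (P.par v) (1 : ℝ) : V → ℝ) +
      ((r - h (P.par v)) / P.len v) • (Pi.single v (1 : ℝ) : V → ℝ) := by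
  funext u
  by_cases h1 : u = v
  · subst h1
    simp [edgePoint_self, (P.par_ne u).symm]
  · by_cases h2 : u = P.par v
    · subst h2
      simp [edgePoint_par, P.par_ne v]
    · simp [edgePoint_of_ne P r h1 h2, h1, h2]

theorem edgePoint_mem {v : V} {r : ℝ} (h1 : h (P.par v) ≤ r) (h2 : r ≤ h v) :
    P.edgePoint v r ∈ realizationSet G := by
  classical
  refine ⟨P.par v, v, Or.inr ((P.adj_iff _ _).2 (Or.inr rfl)), ?_⟩
  refine ⟨1 - (r - h (P.par v)) / P.len v, (r - h (P.par v)) / P.len v, ?_, ?_, by ring, ?_⟩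
  · rw [sub_nonneg, div_le_one (P.len_pos v), len]
    linarith
  · exact div_nonneg (by linarith) (P.len_pos v).le
  · rw [edgePoint_eq]

/-- The half-open edges, containing their upper but not their lower endpoint, cover the tree. By
`edgePoint_inj` they are disjoint, so `top` and `ht` are coordinates on the realization. -/
theorem exists_eq_edgePoint (x : Realization G) :
    ∃ v r, (h (P.par v) < r ∧ r ≤ h v) ∧ x.1 = P.edgePoint v r := by
  classical
  have vertex (a : V) : ∃ v r, (h (P.par v) < r ∧ r ≤ h v) ∧
      (Pi.single a (1 : ℝ) : V → ℝ) = P.edgePoint v r := by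
    refine ⟨a, h a, ⟨P.par_lt a, le_rfl⟩, ?_⟩
    rw [edgePoint_eq, show (h a - h (P.par a)) / P.len a = 1 from div_self (P.len_pos a).ne']
    simp
  have edge (b : V) (s t : ℝ) (hs : 0 ≤ s) (ht : 0 ≤ t) (hst : s + t = 1) :
      ∃ v r, (h (P.par v) < r ∧ r ≤ h v) ∧ s • (Pi.single (P.par b) (1 : ℝ) : V → ℝ) +
        t • (Pi.single b (1 : ℝ) : V → ℝ) = P.edgePoint v r := by
    rcases ht.eq_or_lt with rfl | ht
    · obtain rfl : s = 1 := by linarith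
      simpa using vertex (P.par b)
    · refine ⟨b, h (P.par b) + t * P.len b, ⟨?_, ?_⟩, ?_⟩
      · nlinarith [P.len_pos b]
      · have := P.len_pos b
        have h3 : h b = h (P.par b) + P.len b := by simp [len]
        nlinarith
      · rw [edgePoint_eq, add_sub_cancel_left, mul_div_cancel_right₀ _ (P.len_pos b).ne',
          ← hst, add_sub_cancel_right]
  obtain ⟨x, a, b, hab, s, t, hs, ht, hst, hx⟩ := x
  simp only
  rcases hab with rfl | hab
  · obtain ⟨v, r, h1, h2⟩ := vertex a
    refine ⟨v, r, h1, ?_⟩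
    rw [← h2, ← hx, ← add_smul, hst, one_smul]
  · rcases (P.adj_iff a b).1 hab with rfl | rfl
    · obtain ⟨v, r, h1, h2⟩ := edge a t s ht hs (by linarith)
      refine ⟨v, r, h1, ?_⟩
      rw [← h2, ← hx, add_comm]
    · obtain ⟨v, r, h1, h2⟩ := edge b s t hs ht hst
      refine ⟨v, r, h1, ?_⟩
      rw [← h2, ← hx]

theorem edgePoint_apply_pos {v u : V} {r : ℝ} (hu : P.edgePoint v r u ≠ 0) :
    v = u ∨ P.par v = u := by
  by_contra! hne
  exact hu (P.edgePoint_of_ne r hne.1.symm hne.2.symm)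

theorem edgePoint_inj {v w : V} {r s : ℝ} (hr : h (P.par v) < r) (hs : h (P.par w) < s)
    (e : P.edgePoint v r = P.edgePoint w s) : v = w ∧ r = s := by
  have h1 : P.edgePoint v r v ≠ 0 := by
    rw [edgePoint_self]
    exact (div_pos (sub_pos.2 hr) (P.len_pos v)).ne'
  have h2 : P.edgePoint w s w ≠ 0 := by
    rw [edgePoint_self]
    exact (div_pos (sub_pos.2 hs) (P.len_pos w)).ne'
  have hvw : v = w := by
    rcases P.edgePoint_apply_pos (e ▸ h1) with e1 | e1
    · exact e1.symm
    · rcases P.edgePoint_apply_pos (e.symm ▸ h2) with e2 | e2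
      · exact e2
      · have a1 := P.par_lt v
        have a2 := P.par_lt w
        rw [e1] at a2
        rw [e2] at a1
        exact absurd a1 a2.asymm
  subst hvw
  have e3 := congrFun e v
  rw [edgePoint_self, edgePoint_self, div_left_inj' (P.len_pos v).ne'] at e3
  exact ⟨rfl, by linarith⟩

/-- The upper endpoint of the edge carrying `x`, chosen such that `x` is not its lower endpoint. -/
def top (x : Realization G) : V := (P.exists_eq_edgePoint x).choose

/-- The height of a point of the realization. -/
def ht (x : Realization G) : ℝ := (P.exists_eq_edgePoint x).choose_spec.choose

theorem par_top_lt (x : Realization G) : h (P.par (P.top x)) < P.ht x :=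
  (P.exists_eq_edgePoint x).choose_spec.choose_spec.1.1

theorem ht_le_top (x : Realization G) : P.ht x ≤ h (P.top x) :=
  (P.exists_eq_edgePoint x).choose_spec.choose_spec.1.2

theorem val_eq (x : Realization G) : x.1 = P.edgePoint (P.top x) (P.ht x) :=
  (P.exists_eq_edgePoint x).choose_spec.choose_spec.2

/-- The point at height `r` on the edge below `v`. -/
def point (v : V) (r : ℝ) (h1 : h (P.par v) < r) (h2 : r ≤ h v) : Realization G :=
  ⟨P.edgePoint v r, P.edgePoint_mem h1.le h2⟩

theorem top_point (v : V) (r : ℝ) (h1 : h (P.par v) < r) (h2 : r ≤ h v) :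
    P.top (P.point v r h1 h2) = v :=
  (P.edgePoint_inj h1 (P.par_top_lt _) (P.val_eq (P.point v r h1 h2))).1.symm

theorem ht_point (v : V) (r : ℝ) (h1 : h (P.par v) < r) (h2 : r ≤ h v) :
    P.ht (P.point v r h1 h2) = r :=
  (P.edgePoint_inj h1 (P.par_top_lt _) (P.val_eq (P.point v r h1 h2))).2.symm

theorem ext_top {x y : Realization G} (h1 : P.top x = P.top y) (h2 : P.ht x = P.ht y) : x = y :=
  Subtype.ext (by rw [P.val_eq x, P.val_eq y, h1, h2])

theorem affineHeight_eq (x : Realization G) : affineHeight h x = P.ht x := by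
  classical
  have hsupp : Function.support (fun v => x.1 v * h v) ⊆
      (({P.par (P.top x), P.top x} : Finset V) : Set V) := by
    intro u hu
    have : x.1 u ≠ 0 := fun e => hu (by simp [e])
    rw [P.val_eq x] at this
    rcases P.edgePoint_apply_pos this with e | e <;> simp [← e]
  rw [affineHeight, finsum_eq_sum_of_support_subset _ hsupp, Finset.sum_pair (P.par_ne _),
    P.val_eq x, edgePoint_self, edgePoint_par]
  have h1 := (P.len_pos (P.top x)).ne'
  have h3 : h (P.top x) = h (P.par (P.top x)) + P.len (P.top x) := by simp [len]
  rw [h3]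
  field_simp
  ring

/-! ### Ancestors and merging heights -/

open Classical in
/-- The ancestor of `v` whose lower edge contains a point of height `r`. -/
def ancVertex (v : V) (r : ℝ) : V := P.par^[Nat.find (P.exists_iterate_lt (P.par v) r)] v

theorem exists_ancVertex_eq (v : V) (r : ℝ) : ∃ k, P.par^[k] v = P.ancVertex v r := ⟨_, rfl⟩

theorem par_ancVertex_lt (v : V) (r : ℝ) : h (P.par (P.ancVertex v r)) < r := by
  classical
  rw [ancVertex, ← Function.iterate_succ_apply' P.par, Function.iterate_succ_apply]
  exact Nat.find_spec (P.exists_iterate_lt (P.par v) r)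

theorem le_ancVertex {v : V} {r : ℝ} (hr : r ≤ h v) : r ≤ h (P.ancVertex v r) := by
  classical
  rw [ancVertex]
  rcases Nat.eq_zero_or_pos (Nat.find (P.exists_iterate_lt (P.par v) r)) with e | e
  · simpa [e] using hr
  · obtain ⟨k, hk⟩ := Nat.exists_eq_succ_of_ne_zero e.ne'
    have := Nat.find_min (P.exists_iterate_lt (P.par v) r) (m := k) (by omega)
    rw [hk, Function.iterate_succ_apply]
    exact not_lt.1 this

/-- A descending path meets each height in only one half-open edge. -/
theorem ancVertex_unique {v w : V} {r : ℝ} {k : ℕ} (hk : P.par^[k] v = w)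
    (h1 : h (P.par w) < r) (h2 : r ≤ h w) : P.ancVertex v r = w := by
  obtain ⟨l, hl⟩ := P.exists_ancVertex_eq v r
  have h3 := P.par_ancVertex_lt v r
  have h4 := P.le_ancVertex (h2.trans (hk ▸ P.iterate_le v k))
  rw [← hl] at h3 h4 ⊢
  rw [← hk] at h1 h2 ⊢
  have key (a b : ℕ) (ha : h (P.par (P.par^[a] v)) < r) (hb : r ≤ h (P.par^[b] v)) : b ≤ a := by
    by_contra! hab
    have := P.iterate_le_par (P.par^[a] v) (k := b - a) (by omega)
    rw [← Function.iterate_add_apply, Nat.sub_add_cancel hab.le] at this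
    linarith
  rw [le_antisymm (key _ _ h1 h4) (key _ _ h3 h2)]

theorem ancVertex_ancVertex {v : V} {r s : ℝ} (hr : r ≤ s) (hs : s ≤ h v) :
    P.ancVertex (P.ancVertex v s) r = P.ancVertex v r := by
  obtain ⟨k, hk⟩ := P.exists_ancVertex_eq v s
  obtain ⟨l, hl⟩ := P.exists_ancVertex_eq (P.ancVertex v s) r
  refine (P.ancVertex_unique (k := l + k) ?_ (P.par_ancVertex_lt _ _)
    (P.le_ancVertex (hr.trans (P.le_ancVertex hs)))).symm
  rw [Function.iterate_add_apply, hk, hl]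

/-- The point below `x` at height `min r (ht x)`. -/
def anc (x : Realization G) (r : ℝ) : Realization G :=
  P.point (P.ancVertex (P.top x) (min r (P.ht x))) (min r (P.ht x)) (P.par_ancVertex_lt _ _)
    (P.le_ancVertex ((min_le_right _ _).trans (P.ht_le_top x)))

theorem top_anc (x : Realization G) (r : ℝ) :
    P.top (P.anc x r) = P.ancVertex (P.top x) (min r (P.ht x)) := P.top_point _ _ _ _

theorem ht_anc (x : Realization G) (r : ℝ) : P.ht (P.anc x r) = min r (P.ht x) :=
  P.ht_point _ _ _ _

theorem ancVertex_top (x : Realization G) : P.ancVertex (P.top x) (P.ht x) = P.top x :=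
  P.ancVertex_unique (k := 0) rfl (P.par_top_lt x) (P.ht_le_top x)

theorem anc_of_le {x : Realization G} {r : ℝ} (hr : P.ht x ≤ r) : P.anc x r = x := by
  apply P.ext_top
  · rw [top_anc, min_eq_right hr, ancVertex_top]
  · rw [ht_anc, min_eq_right hr]

theorem anc_anc (x : Realization G) (r s : ℝ) : P.anc (P.anc x r) s = P.anc x (min s r) := by
  apply P.ext_top
  · rw [top_anc, top_anc, top_anc, ht_anc, ← min_assoc, P.ancVertex_ancVertex]
    · exact (min_assoc s r _).le.trans (min_le_right _ _)
    · exact (min_le_right _ _).trans (P.ht_le_top x)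
  · rw [ht_anc, ht_anc, ht_anc, min_assoc]

theorem anc_eq_anc_iff {x y : Realization G} {r : ℝ} (hx : r ≤ P.ht x) (hy : r ≤ P.ht y) :
    P.anc x r = P.anc y r ↔ P.ancVertex (P.top x) r = P.ancVertex (P.top y) r := by
  refine ⟨fun e => ?_, fun e => P.ext_top ?_ ?_⟩
  · simpa [top_anc, hx, hy] using congrArg P.top e
  · simpa [top_anc, hx, hy]
  · simp [ht_anc, hx, hy]

/-- The heights at which `x` and `y` have the same ancestor. -/
def commonHeights (x y : Realization G) : Set ℝ :=
  {r | r ≤ P.ht x ∧ r ≤ P.ht y ∧ P.anc x r = P.anc y r}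

/-- The height of the highest common ancestor of `x` and `y`. -/
def meet (x y : Realization G) : ℝ := sSup (P.commonHeights x y)

theorem commonHeights_nonempty (x y : Realization G) : (P.commonHeights x y).Nonempty := by
  obtain ⟨k, l, hkl⟩ := P.merge (P.top x) (P.top y)
  set w := P.par^[k] (P.top x) with hw
  have hx : h (P.par w) < P.ht x := by
    rw [hw, ← Function.iterate_succ_apply' P.par]
    exact (P.iterate_le_par _ (by omega)).trans_lt (P.par_top_lt x)
  have hy : h (P.par w) < P.ht y := by
    rw [hkl, ← Function.iterate_succ_apply' P.par]
    exact (P.iterate_le_par _ (by omega)).trans_lt (P.par_top_lt y)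
  refine ⟨h (P.par w), hx.le, hy.le, (P.anc_eq_anc_iff hx.le hy.le).2 ?_⟩
  rw [P.ancVertex_unique (v := P.top x) (w := P.par w) (k := k + 1) ?_ (P.par_lt _) le_rfl,
    P.ancVertex_unique (v := P.top y) (w := P.par w) (k := l + 1) ?_ (P.par_lt _) le_rfl]
  · rw [Function.iterate_succ_apply', hkl]
  · rw [Function.iterate_succ_apply']

theorem mem_commonHeights_of_le {x y : Realization G} {r s : ℝ} (hrs : r ≤ s)
    (hs : s ∈ P.commonHeights x y) : r ∈ P.commonHeights x y := by
  refine ⟨hrs.trans hs.1, hrs.trans hs.2.1, ?_⟩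
  rw [← min_eq_left hrs, ← P.anc_anc, ← P.anc_anc, hs.2.2]

theorem bddAbove_commonHeights (x y : Realization G) : BddAbove (P.commonHeights x y) :=
  ⟨P.ht x, fun _ hr => hr.1⟩

/-- The supremum is attained because edges are open at the bottom: a common height just below it
lies, on both descending paths, on the same edge as the supremum itself, so these edges agree. -/
theorem meet_mem (x y : Realization G) : P.meet x y ∈ P.commonHeights x y := by
  set m := P.meet x y with hm
  have hx : m ≤ P.ht x := csSup_le (P.commonHeights_nonempty x y) fun _ hr => hr.1
  have hy : m ≤ P.ht y := csSup_le (P.commonHeights_nonempty x y) fun _ hr => hr.2.1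
  refine ⟨hx, hy, (P.anc_eq_anc_iff hx hy).2 ?_⟩
  set a := P.ancVertex (P.top x) m
  set b := P.ancVertex (P.top y) m
  obtain ⟨s, hs, hlt⟩ := exists_lt_of_lt_csSup (P.commonHeights_nonempty x y)
    (max_lt (P.par_ancVertex_lt (P.top x) m) (P.par_ancVertex_lt (P.top y) m))
  have hsm : s ≤ m := le_csSup (P.bddAbove_commonHeights x y) hs
  have e := (P.anc_eq_anc_iff hs.1 hs.2.1).1 hs.2.2
  obtain ⟨k, hk⟩ := P.exists_ancVertex_eq (P.top x) m
  obtain ⟨l, hl⟩ := P.exists_ancVertex_eq (P.top y) m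
  rwa [P.ancVertex_unique hk ((le_max_left _ _).trans_lt hlt)
      (hsm.trans (P.le_ancVertex (hx.trans (P.ht_le_top x)))),
    P.ancVertex_unique hl ((le_max_right _ _).trans_lt hlt)
      (hsm.trans (P.le_ancVertex (hy.trans (P.ht_le_top y))))] at e

theorem le_meet_iff {x y : Realization G} {r : ℝ} :
    r ≤ P.meet x y ↔ r ≤ P.ht x ∧ r ≤ P.ht y ∧ P.anc x r = P.anc y r :=
  ⟨fun hr => P.mem_commonHeights_of_le hr (P.meet_mem x y),
    fun hr => le_csSup (P.bddAbove_commonHeights x y) hr⟩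

theorem meet_le_left (x y : Realization G) : P.meet x y ≤ P.ht x := (P.le_meet_iff.1 le_rfl).1

theorem meet_le_right (x y : Realization G) : P.meet x y ≤ P.ht y := (P.le_meet_iff.1 le_rfl).2.1

theorem meet_comm (x y : Realization G) : P.meet x y = P.meet y x := by
  have key (x y : Realization G) : P.meet x y ≤ P.meet y x := by
    obtain ⟨h1, h2, h3⟩ := P.le_meet_iff.1 (le_refl (P.meet x y))
    exact P.le_meet_iff.2 ⟨h2, h1, h3.symm⟩
  exact le_antisymm (key _ _) (key _ _)

/-- Ultrametric inequality: below both merging heights all three points share their ancestors. Most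
later height estimates rest on it. -/
theorem min_meet_le (x y z : Realization G) : min (P.meet x y) (P.meet y z) ≤ P.meet x z := by
  obtain ⟨h1, h2, h3⟩ := P.le_meet_iff.1 (min_le_left (P.meet x y) (P.meet y z))
  obtain ⟨h4, h5, h6⟩ := P.le_meet_iff.1 (min_le_right (P.meet x y) (P.meet y z))
  exact P.le_meet_iff.2 ⟨h1, h5, h3.trans h6⟩

theorem meet_eq_ht {x y : Realization G} {k : ℕ} (hk : P.par^[k] (P.top y) = P.top x)
    (hle : P.ht x ≤ P.ht y) : P.meet y x = P.ht x := by
  refine le_antisymm (P.meet_le_right _ _) (P.le_meet_iff.2 ⟨hle, le_rfl, ?_⟩)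
  rw [P.anc_eq_anc_iff hle le_rfl, ancVertex_top,
    P.ancVertex_unique hk (P.par_top_lt x) (P.ht_le_top x)]

theorem meet_anc (x y : Realization G) (r : ℝ) : P.meet (P.anc x r) y = min r (P.meet x y) := by
  refine eq_of_forall_le_iff fun s => ?_
  rw [P.le_meet_iff, le_min_iff, P.le_meet_iff, ht_anc, le_min_iff, anc_anc]
  constructor
  · rintro ⟨⟨h1, h2⟩, h3, h4⟩
    exact ⟨h1, h2, h3, by rwa [min_eq_left h1] at h4⟩
  · rintro ⟨h1, h2, h3, h4⟩
    exact ⟨⟨h1, h2⟩, h3, by rwa [min_eq_left h1]⟩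

/-! ### Continuity of the height and of the merging height -/

theorem top_or_par_top_of_apply_pos {x : Realization G} {v : V} (hv : x.1 v ≠ 0) :
    P.top x = v ∨ P.par (P.top x) = v := by
  rw [P.val_eq x] at hv
  exact P.edgePoint_apply_pos hv

theorem isOpen_apply_pos (v : V) : IsOpen {x : Realization G | 0 < x.1 v} :=
  isOpen_lt continuous_const ((continuous_apply v).comp continuous_subtype_val)

theorem apply_top_pos (x : Realization G) : 0 < x.1 (P.top x) := by
  rw [P.val_eq x, edgePoint_self]
  exact div_pos (sub_pos.2 (P.par_top_lt x)) (P.len_pos _)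

/-- Near x only `top x`, its parent and its finitely many children can have nonzero coordinates, so
the sum is locally finite. -/
theorem continuous_ht : Continuous P.ht := by
  have e : P.ht = fun x => ∑ᶠ v, x.1 v * h v := funext fun x => (P.affineHeight_eq x).symm
  rw [e]
  refine continuous_finsum (fun v => ?_) fun x => ?_
  · exact ((continuous_apply v).comp continuous_subtype_val).mul continuous_const
  · refine ⟨{y | 0 < y.1 (P.top x)}, (isOpen_apply_pos _).mem_nhds (P.apply_top_pos x), ?_⟩
    set v := P.top x
    refine (((Set.finite_singleton v).union (Set.finite_singleton (P.par v))).union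
      (P.children_finite v)).subset ?_
    rintro u ⟨y, hy1, hy2⟩
    have hu : y.1 u ≠ 0 := fun e => hy1 (by simp [e])
    have hv : y.1 v ≠ 0 := ne_of_gt hy2
    rcases P.top_or_par_top_of_apply_pos hu with e1 | e1 <;>
    rcases P.top_or_par_top_of_apply_pos hv with e2 | e2
    · simp [← e1, e2]
    · rw [e1] at e2
      simp [e2]
    · rw [e2] at e1
      simp [← e1]
    · simp [← e1, e2]

/-- Points near x lie on the edge of x or, if x is a vertex, possibly on an edge above it. In each
case one of the two points is an ancestor of the other. -/
theorem eventually_meet_eq (x : Realization G) :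
    ∀ᶠ y in 𝓝 x, P.meet y x = min (P.ht y) (P.ht x) := by
  have same (x y : Realization G) (e : P.top y = P.top x) : P.meet y x = min (P.ht y) (P.ht x) := by
    rcases le_total (P.ht x) (P.ht y) with hle | hle
    · rw [min_eq_right hle, P.meet_eq_ht (k := 0) e hle]
    · rw [min_eq_left hle, P.meet_comm, P.meet_eq_ht (k := 0) e.symm hle]
  have hv := (isOpen_apply_pos _).mem_nhds (P.apply_top_pos x)
  rcases (P.ht_le_top x).eq_or_lt with e | hlt
  · filter_upwards [hv] with y hy
    rcases P.top_or_par_top_of_apply_pos (ne_of_gt hy) with e1 | e1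
    · exact same _ _ e1
    · have : P.ht x ≤ P.ht y := by
        rw [e, ← e1]
        exact (P.par_top_lt y).le
      rw [min_eq_right this, P.meet_eq_ht (k := 1) e1 this]
  · have hp : 0 < x.1 (P.par (P.top x)) := by
      rw [P.val_eq x, edgePoint_par, sub_pos, div_lt_one (P.len_pos _), len]
      linarith
    filter_upwards [hv, (isOpen_apply_pos _).mem_nhds hp] with y hy hy'
    refine same _ _ ?_
    rcases P.top_or_par_top_of_apply_pos (ne_of_gt hy) with e1 | e1
    · exact e1
    · rcases P.top_or_par_top_of_apply_pos (ne_of_gt hy') with e2 | e2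
      · have a1 := P.par_lt (P.top y)
        have a2 := P.par_lt (P.top x)
        rw [e1] at a1
        rw [← e2] at a2
        exact absurd a1 a2.asymm
      · exact absurd (e2.symm.trans e1) (P.par_ne _)

/-- Two ultrametric inequalities replace one point at a time. The subtracted terms tend to 0 as x' →
x and y' → y, which gives continuity of `meet` in both variables. -/
theorem meet_sub_le (x x' y y' : Realization G) :
    P.meet x y - ((P.ht x - P.meet x' x) + (P.ht y - P.meet y' y)) ≤ P.meet x' y' := by
  have h1 := P.min_meet_le x' x y'
  have h2 := P.min_meet_le x y y'
  have h3 := P.meet_le_left x y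
  have h4 := P.meet_le_right x y
  have h5 := P.meet_le_right x' x
  have h6 := P.meet_le_right y' y
  rw [P.meet_comm y' y] at *
  rcases min_le_iff.1 h1 with h1 | h1 <;> rcases min_le_iff.1 h2 with h2 | h2 <;> linarith

theorem continuous_meet : Continuous fun p : Realization G × Realization G => P.meet p.1 p.2 := by
  rw [continuous_iff_continuousAt]
  rintro ⟨x, y⟩
  have hm (x : Realization G) : Filter.Tendsto (fun x' => P.meet x' x) (𝓝 x) (𝓝 (P.ht x)) := by
    have : Filter.Tendsto (fun x' => min (P.ht x') (P.ht x)) (𝓝 x) (𝓝 (P.ht x)) := by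
      simpa using (P.continuous_ht.min continuous_const).tendsto (f := fun x' => min (P.ht x')
        (P.ht x)) x
    exact this.congr' ((P.eventually_meet_eq x).mono fun _ e => e.symm)
  have hx := (hm x).comp (continuous_fst.tendsto (x, y))
  have hy := (hm y).comp (continuous_snd.tendsto (x, y))
  have hx' := (P.continuous_ht.tendsto x).comp (continuous_fst.tendsto (x, y))
  have hy' := (P.continuous_ht.tendsto y).comp (continuous_snd.tendsto (x, y))
  refine tendsto_of_tendsto_of_tendsto_of_le_of_le
    (g := fun p : Realization G × Realization G =>
      P.meet x y - ((P.ht x - P.meet p.1 x) + (P.ht y - P.meet p.2 y)))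
    (h := fun p : Realization G × Realization G =>
      P.meet x y + ((P.ht p.1 - P.meet p.1 x) + (P.ht p.2 - P.meet p.2 y))) ?_ ?_
    (fun p => P.meet_sub_le x p.1 y p.2) (fun p => ?_)
  · have := tendsto_const_nhds (x := P.meet x y) |>.sub
      ((tendsto_const_nhds (x := P.ht x) |>.sub hx).add (tendsto_const_nhds (x := P.ht y) |>.sub hy))
    simpa using this
  · have := tendsto_const_nhds (x := P.meet x y) |>.add ((hx'.sub hx).add (hy'.sub hy))
    simpa using this
  · have := P.meet_sub_le p.1 x p.2 y
    rw [P.meet_comm x, P.meet_comm y] at this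
    simp only
    linarith

/-! ### Continuity of descending and rising -/

/-- The vertex `v` as a point of the realization. -/
def vertex (v : V) : Realization G := P.point v (h v) (P.par_lt v) le_rfl

theorem top_vertex (v : V) : P.top (P.vertex v) = v := P.top_point _ _ _ _

theorem ht_vertex (v : V) : P.ht (P.vertex v) = h v := P.ht_point _ _ _ _

/-- The part of the edge below `v` that lies below `x`, as a proportion of its length. -/
def filled (v : V) (x : Realization G) : ℝ :=
  max 0 ((P.meet x (P.vertex v) - h (P.par v)) / P.len v)

theorem filled_top (x : Realization G) :
    P.filled (P.top x) x = (P.ht x - h (P.par (P.top x))) / P.len (P.top x) := by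
  rw [filled, P.meet_comm, P.meet_eq_ht (k := 0) (P.top_vertex _)
    ((P.ht_le_top x).trans_eq (P.ht_vertex _).symm)]
  exact max_eq_right (div_pos (sub_pos.2 (P.par_top_lt x)) (P.len_pos _)).le

theorem filled_ancestor (x : Realization G) {k : ℕ} (hk : k ≠ 0) :
    P.filled (P.par^[k] (P.top x)) x = 1 := by
  rw [filled, P.meet_eq_ht (k := k) (P.top_vertex _).symm, ht_vertex,
    show (_ - _) / P.len _ = 1 from div_self (P.len_pos _).ne']
  · simp
  · rw [ht_vertex]
    exact (P.iterate_le_par _ hk).trans (P.par_top_lt x).le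

theorem filled_eq_zero (x : Realization G) {v : V} (hv : ∀ k, P.par^[k] (P.top x) ≠ v) :
    P.filled v x = 0 := by
  refine max_eq_left (div_nonpos_of_nonpos_of_nonneg ?_ (P.len_pos v).le)
  by_contra! hlt
  have hlt : h (P.par v) < P.meet x (P.vertex v) := by linarith
  obtain ⟨h1, h2, h3⟩ := P.le_meet_iff.1 (le_refl (P.meet x (P.vertex v)))
  rw [P.anc_eq_anc_iff h1 h2, top_vertex] at h3
  rw [P.ancVertex_unique (v := v) (k := 0) rfl hlt (h2.trans_eq (P.ht_vertex v))] at h3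
  obtain ⟨k, hk⟩ := P.exists_ancVertex_eq (P.top x) (P.meet x (P.vertex v))
  exact hv k (hk.trans h3)

theorem continuous_filled (v : V) : Continuous (P.filled v) := by
  refine continuous_const.max (Continuous.div_const (Continuous.sub ?_ continuous_const) _)
  exact P.continuous_meet.comp (continuous_id.prodMk continuous_const)

/-- On the edges of the path below x, `filled` is 1 except for a proportion on the edge carrying x;
on all other edges it is 0. Subtracting the children from v leaves the barycentric coordinate. -/
theorem apply_eq_filled_sub (x : Realization G) (v : V) :
    x.1 v = P.filled v x - ∑ c ∈ (P.children_finite v).toFinset, P.filled c x := by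
  set w := P.top x with hw
  by_cases hanc : ∃ k, P.par^[k] w = v
  · obtain ⟨k, hk⟩ := hanc
    rcases Nat.eq_zero_or_pos k with rfl | hk0
    · obtain rfl : w = v := hk
      rw [Finset.sum_eq_zero, hw, P.filled_top, sub_zero]
      · conv_lhs => rw [P.val_eq x]
        rw [edgePoint_self]
      · intro c hc
        have hc : P.par c = w := by simpa using hc
        refine P.filled_eq_zero x fun k e => ?_
        have h1 := P.iterate_le (P.top x) k
        have h2 := P.par_lt c
        rw [e, ← hw] at h1
        rw [hc] at h2
        linarith
    · obtain ⟨k, rfl⟩ := Nat.exists_eq_succ_of_ne_zero hk0.ne'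
      rw [Finset.sum_eq_single (P.par^[k] w)]
      · rw [← hk, P.filled_ancestor x (Nat.succ_ne_zero k)]
        rcases Nat.eq_zero_or_pos k with rfl | hk1
        · simp only [Function.iterate_succ, Function.iterate_zero, Function.comp_apply, id_eq]
          rw [hw, P.filled_top]
          conv_lhs => rw [P.val_eq x]
          rw [edgePoint_par]
        · rw [P.filled_ancestor x hk1.ne', sub_self, P.val_eq x, P.edgePoint_of_ne]
          · exact (P.iterate_injective w).ne (a₂ := 0) (Nat.succ_ne_zero k)
          · exact (P.iterate_injective w).ne (a₂ := 1) (by omega)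
      · intro c hc hne
        have hc : P.par c = v := by simpa using hc
        refine P.filled_eq_zero x fun l e => ?_
        have e2 : P.par^[l + 1] w = P.par^[k + 1] w := by
          rw [Function.iterate_succ_apply', e, hc, hk]
        have := P.iterate_injective w e2
        obtain rfl : l = k := by omega
        exact hne e.symm
      · intro hn
        simp [← hk, Function.iterate_succ_apply'] at hn
  · push Not at hanc
    rw [P.filled_eq_zero x hanc, Finset.sum_eq_zero, sub_zero, P.val_eq x, P.edgePoint_of_ne]
    · exact (hanc 0).symm
    · exact (hanc 1).symm
    · intro c hc
      have hc : P.par c = v := by simpa using hc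
      refine P.filled_eq_zero x fun k e => hanc (k + 1) ?_
      rw [Function.iterate_succ_apply', e, hc]

/-- Reduces the continuity of maps into the tree to that of the functions `filled v`, which `anc`
and `rise` transform by explicit formulas. -/
theorem continuous_of_filled {Z : Type*} [TopologicalSpace Z] {f : Z → Realization G}
    (hf : ∀ v, Continuous fun z => P.filled v (f z)) : Continuous f := by
  refine continuous_induced_rng.2 (continuous_pi fun v => ?_)
  simp only [Function.comp_def, P.apply_eq_filled_sub]
  exact (hf v).sub (continuous_finsetSum _ fun c _ => hf c)

theorem continuous_anc : Continuous fun p : Realization G × ℝ => P.anc p.1 p.2 := by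
  refine P.continuous_of_filled fun v => ?_
  simp only [filled, meet_anc]
  refine continuous_const.max (Continuous.div_const (Continuous.sub ?_ continuous_const) _)
  exact continuous_snd.min (P.continuous_meet.comp (continuous_fst.prodMk continuous_const))

theorem rise_aux (s : ℝ) (x : Realization G) :
    P.ht x ≤ min (h (P.top x)) (P.ht x + max 0 s * (P.ht x - h (P.par (P.top x)))) := by
  refine le_min (P.ht_le_top x) ?_
  have := mul_nonneg (le_max_left 0 s) (sub_pos.2 (P.par_top_lt x)).le
  linarith

/-- The points in the upper part of each edge are pushed to its upper endpoint. -/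
def rise (s : ℝ) (x : Realization G) : Realization G :=
  P.point (P.top x) (min (h (P.top x)) (P.ht x + max 0 s * (P.ht x - h (P.par (P.top x)))))
    ((P.par_top_lt x).trans_le (P.rise_aux s x)) (min_le_left _ _)

theorem top_rise (s : ℝ) (x : Realization G) : P.top (P.rise s x) = P.top x := P.top_point _ _ _ _

theorem ht_rise (s : ℝ) (x : Realization G) : P.ht (P.rise s x) =
    min (h (P.top x)) (P.ht x + max 0 s * (P.ht x - h (P.par (P.top x)))) := P.ht_point _ _ _ _

/-- On every edge the filled proportion is stretched by 1 + s (for s ≥ 0) and cut off at 1. At s = 1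
the upper half of an edge collapses to its upper endpoint. -/
theorem filled_rise (s : ℝ) (x : Realization G) (v : V) :
    P.filled v (P.rise s x) = min 1 ((1 + max 0 s) * P.filled v x) := by
  by_cases hanc : ∃ k, P.par^[k] (P.top x) = v
  · obtain ⟨k, hk⟩ := hanc
    rcases Nat.eq_zero_or_pos k with rfl | hk0
    · obtain rfl : P.top x = v := hk
      rw [P.filled_top]
      have := P.filled_top (P.rise s x)
      rw [top_rise] at this
      rw [this, ht_rise]
      have hl := P.len_pos (P.top x)
      rw [← min_sub_sub_right, ← min_div_div_right hl.le,
        show (_ - _) / P.len _ = 1 from div_self hl.ne']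
      congr 1
      ring
    · have := P.filled_ancestor (P.rise s x) hk0.ne'
      rw [top_rise, hk] at this
      rw [this, ← hk, P.filled_ancestor x hk0.ne', mul_one, min_eq_left]
      have := le_max_left 0 s
      linarith
  · push Not at hanc
    rw [P.filled_eq_zero x hanc, P.filled_eq_zero]
    · simp
    · simpa [top_rise] using hanc

theorem continuous_rise : Continuous fun p : ℝ × Realization G => P.rise p.1 p.2 := by
  refine P.continuous_of_filled fun v => ?_
  simp only [filled_rise]
  exact continuous_const.min ((continuous_const.add (continuous_const.max continuous_fst)).mul
    ((P.continuous_filled v).comp continuous_snd))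

theorem rise_zero (x : Realization G) : P.rise 0 x = x := by
  apply P.ext_top (P.top_rise _ _)
  simp [ht_rise, P.ht_le_top]

theorem le_ht_rise (s : ℝ) (x : Realization G) : P.ht x ≤ P.ht (P.rise s x) := by
  rw [ht_rise]
  exact P.rise_aux s x

/-- The hypothesis forces x to be a vertex. Nearby points fill more than half of the edge below x,
so after rising they are at x or above it. -/
theorem eventually_meet_rise {x : Realization G} (hx : P.ht (P.rise 1 x) = P.ht x) :
    ∀ᶠ y in 𝓝 x, P.meet (P.rise 1 y) x = P.ht x := by
  have e : P.ht x = h (P.top x) := by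
    rw [ht_rise] at hx
    have := P.par_top_lt x
    rcases min_cases (h (P.top x)) (P.ht x + max 0 1 * (P.ht x - h (P.par (P.top x))))
      with ⟨h1, -⟩ | ⟨h1, -⟩
    · rw [h1] at hx
      exact hx.symm
    · rw [h1] at hx
      norm_num at hx
      linarith
  have hxv : P.vertex (P.top x) = x := P.ext_top (P.top_vertex _) ((P.ht_vertex _).trans e.symm)
  have h1 : P.filled (P.top x) x = 1 := by
    rw [filled_top, e]
    exact div_self (P.len_pos _).ne'
  have : ∀ᶠ y in 𝓝 x, 1 / 2 < P.filled (P.top x) y :=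
    (P.continuous_filled _).continuousAt.eventually (lt_mem_nhds (by rw [h1]; norm_num))
  filter_upwards [this] with y hy
  have h2 := P.filled_rise 1 y (P.top x)
  rw [min_eq_left (by norm_num; linarith), filled, hxv] at h2
  have hl := P.len_pos (P.top x)
  have h3 : (P.meet (P.rise 1 y) x - h (P.par (P.top x))) / P.len (P.top x) = 1 := by
    rcases max_cases 0 ((P.meet (P.rise 1 y) x - h (P.par (P.top x))) / P.len (P.top x))
      with ⟨h3, -⟩ | ⟨h3, -⟩
    · rw [h3] at h2
      norm_num at h2
    · rw [← h3, h2]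
  rw [div_eq_one_iff_eq hl.ne', len] at h3
  linarith

theorem exists_above (x : Realization G) (r : ℝ) : ∃ p, r ≤ P.ht p ∧ P.meet x p = P.ht x := by
  obtain ⟨w, k, hk, hw⟩ := P.exists_descendant (P.top x) (max r (P.ht x))
  refine ⟨P.vertex w, ?_, ?_⟩
  · rw [ht_vertex]
    exact (le_max_left _ _).trans hw
  · rw [P.meet_comm, P.meet_eq_ht (k := k)]
    · rw [top_vertex, hk]
    · rw [ht_vertex]
      exact (le_max_right _ _).trans hw

/-- Take a low vertex v with two children and a high descendant of each child. Slightly above v the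
ancestors of these descendants lie on different edges, so they merge exactly at v. -/
theorem exists_branch [Nonempty V] (r : ℝ) : ∃ v, P.ht v ≤ r ∧ ∀ s, ∃ p q, s ≤ P.ht p ∧
    s ≤ P.ht q ∧ P.meet v p = P.ht v ∧ P.meet v q = P.ht v ∧ P.meet p q = P.ht v := by
  obtain ⟨k, hk⟩ := P.exists_iterate_lt (Classical.arbitrary V) r
  set v := P.par^[k] (Classical.arbitrary V)
  obtain ⟨c, d, hcd, hc, hd⟩ := P.two_children v
  have hcv : h v < h c := hc ▸ P.par_lt c
  have hdv : h v < h d := hd ▸ P.par_lt d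
  refine ⟨P.vertex v, (P.ht_vertex v).trans_le hk.le, fun s => ?_⟩
  obtain ⟨p, i, hpc, hp⟩ := P.exists_descendant c s
  obtain ⟨q, j, hqd, hq⟩ := P.exists_descendant d s
  have hvp : P.meet (P.vertex v) (P.vertex p) = P.ht (P.vertex v) := by
    rw [P.meet_comm, P.meet_eq_ht (k := i + 1)]
    · rw [top_vertex, top_vertex, Function.iterate_succ_apply', hpc, hc]
    · rw [ht_vertex, ht_vertex]
      exact hcv.le.trans (hpc ▸ P.iterate_le p i)
  have hvq : P.meet (P.vertex v) (P.vertex q) = P.ht (P.vertex v) := by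
    rw [P.meet_comm, P.meet_eq_ht (k := j + 1)]
    · rw [top_vertex, top_vertex, Function.iterate_succ_apply', hqd, hd]
    · rw [ht_vertex, ht_vertex]
      exact hdv.le.trans (hqd ▸ P.iterate_le q j)
  refine ⟨P.vertex p, P.vertex q, ?_, ?_, hvp, hvq, le_antisymm ?_ ?_⟩
  · rwa [ht_vertex]
  · rwa [ht_vertex]
  · by_contra! hlt
    rw [ht_vertex] at hlt
    obtain ⟨r, hr1, hr2⟩ : ∃ r, h v < r ∧ r ≤ min (P.meet (P.vertex p) (P.vertex q))
        (min (h c) (h d)) := ⟨_, lt_min hlt (lt_min hcv hdv), le_rfl⟩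
    obtain ⟨h1, h2, h3⟩ := P.le_meet_iff.1 (hr2.trans (min_le_left _ _))
    rw [P.anc_eq_anc_iff h1 h2, top_vertex, top_vertex,
      P.ancVertex_unique hpc (hc.symm ▸ hr1)
        (hr2.trans ((min_le_right _ _).trans (min_le_left _ _))),
      P.ancVertex_unique hqd (hd.symm ▸ hr1)
        (hr2.trans ((min_le_right _ _).trans (min_le_right _ _)))] at h3
    exact hcd h3
  · have := P.min_meet_le (P.vertex p) (P.vertex v) (P.vertex q)
    rwa [P.meet_comm (P.vertex p), hvp, hvq, min_self] at this

end ParentData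

/-! ### Merge trees and their geodesics -/

/-- A topological tree with a height function and one descending end, in terms of the ancestors
of its points and the heights at which two points merge. -/
structure MergeTree (X : Type u) [TopologicalSpace X] where
  ht : X → ℝ
  anc : X → ℝ → X
  meet : X → X → ℝ
  rise : ℝ → X → X
  continuous_ht : Continuous ht
  continuous_anc : Continuous fun p : X × ℝ => anc p.1 p.2
  continuous_meet : Continuous fun p : X × X => meet p.1 p.2
  continuous_rise : Continuous fun p : ℝ × X => rise p.1 p.2
  ht_anc : ∀ x r, ht (anc x r) = min r (ht x)
  anc_of_le : ∀ {x r}, ht x ≤ r → anc x r = x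
  meet_anc : ∀ x y r, meet (anc x r) y = min r (meet x y)
  le_meet_iff : ∀ {x y r}, r ≤ meet x y ↔ r ≤ ht x ∧ r ≤ ht y ∧ anc x r = anc y r
  rise_zero : ∀ x, rise 0 x = x
  le_ht_rise : ∀ s x, ht x ≤ ht (rise s x)
  eventually_meet_rise : ∀ {x}, ht (rise 1 x) = ht x → ∀ᶠ y in 𝓝 x, meet (rise 1 y) x = ht x
  exists_above : ∀ x r, ∃ p, r ≤ ht p ∧ meet x p = ht x
  exists_branch : ∀ r, ∃ v, ht v ≤ r ∧ ∀ s, ∃ p q, s ≤ ht p ∧ s ≤ ht q ∧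
    meet v p = ht v ∧ meet v q = ht v ∧ meet p q = ht v

/-- The realization of a tree with one descending end as a topological merge tree. -/
def ParentData.mergeTree {V : Type u} [Nonempty V] {G : SimpleGraph V} {h : V → ℝ}
    (P : ParentData G h) : MergeTree (Realization G) where
  ht := P.ht
  anc := P.anc
  meet := P.meet
  rise := P.rise
  continuous_ht := P.continuous_ht
  continuous_anc := P.continuous_anc
  continuous_meet := P.continuous_meet
  continuous_rise := P.continuous_rise
  ht_anc := P.ht_anc
  anc_of_le := P.anc_of_le
  meet_anc := P.meet_anc
  le_meet_iff := P.le_meet_iff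
  rise_zero := P.rise_zero
  le_ht_rise := P.le_ht_rise
  eventually_meet_rise := P.eventually_meet_rise
  exists_above := P.exists_above
  exists_branch := P.exists_branch

namespace MergeTree

section Geodesic

variable {X : Type u} [TopologicalSpace X] (T : MergeTree X)

theorem meet_le_left (x y : X) : T.meet x y ≤ T.ht x := (T.le_meet_iff.1 le_rfl).1

theorem meet_le_right (x y : X) : T.meet x y ≤ T.ht y := (T.le_meet_iff.1 le_rfl).2.1

theorem anc_meet (x y : X) : T.anc x (T.meet x y) = T.anc y (T.meet x y) :=
  (T.le_meet_iff.1 le_rfl).2.2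

theorem meet_self (x : X) : T.meet x x = T.ht x :=
  le_antisymm (T.meet_le_left x x) (T.le_meet_iff.2 ⟨le_rfl, le_rfl, rfl⟩)

theorem meet_comm (x y : X) : T.meet x y = T.meet y x :=
  le_antisymm (T.le_meet_iff.2 ⟨T.meet_le_right _ _, T.meet_le_left _ _, (T.anc_meet x y).symm⟩)
    (T.le_meet_iff.2 ⟨T.meet_le_right _ _, T.meet_le_left _ _, (T.anc_meet y x).symm⟩)

theorem min_meet_le (x y z : X) : min (T.meet x y) (T.meet y z) ≤ T.meet x z := by
  obtain ⟨h1, h2, h3⟩ := T.le_meet_iff.1 (min_le_left (T.meet x y) (T.meet y z))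
  obtain ⟨h4, h5, h6⟩ := T.le_meet_iff.1 (min_le_right (T.meet x y) (T.meet y z))
  exact T.le_meet_iff.2 ⟨h1, h5, h3.trans h6⟩

/-- The signed height on the geodesic from `x` to `y` at time `t`, where the part after the
turning point is reflected downwards. -/
def level (x y : X) (t : ℝ) : ℝ := T.ht x - t * (T.ht x + T.ht y - 2 * T.meet x y)

/-- The geodesic from `x` to `y`, parametrized on `[0, 1]`. -/
def geodesic (x y : X) (t : ℝ) : X :=
  open Classical in
  if T.meet x y ≤ T.level x y t then T.anc x (T.level x y t)
  else T.anc y (2 * T.meet x y - T.level x y t)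

theorem continuous_geodesic :
    Continuous fun p : (X × X) × ℝ => T.geodesic p.1.1 p.1.2 p.2 := by
  have hm : Continuous fun p : (X × X) × ℝ => T.meet p.1.1 p.1.2 :=
    T.continuous_meet.comp continuous_fst
  have hx : Continuous fun p : (X × X) × ℝ => T.ht p.1.1 :=
    T.continuous_ht.comp (continuous_fst.comp continuous_fst)
  have hy : Continuous fun p : (X × X) × ℝ => T.ht p.1.2 :=
    T.continuous_ht.comp (continuous_snd.comp continuous_fst)
  have hl : Continuous fun p : (X × X) × ℝ => T.level p.1.1 p.1.2 p.2 :=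
    hx.sub (continuous_snd.mul ((hx.add hy).sub (continuous_const.mul hm)))
  refine Continuous.if_le ?_ ?_ hm hl ?_
  · exact T.continuous_anc.comp ((continuous_fst.comp continuous_fst).prodMk hl)
  · exact T.continuous_anc.comp ((continuous_snd.comp continuous_fst).prodMk
      ((continuous_const.mul hm).sub hl))
  · intro p e
    rw [← e, T.anc_meet]
    congr 1
    ring

theorem geodesic_zero (x y : X) : T.geodesic x y 0 = x := by
  rw [geodesic, level, zero_mul, sub_zero, if_pos (T.meet_le_left x y), T.anc_of_le le_rfl]

theorem geodesic_one (x y : X) : T.geodesic x y 1 = y := by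
  rw [geodesic, level]
  split_ifs with hle
  · have := T.meet_le_right x y
    have e : T.meet x y = T.ht y := by linarith
    rw [show T.ht x - 1 * (T.ht x + T.ht y - 2 * T.meet x y) = T.meet x y by linarith,
      T.anc_meet, T.anc_of_le e.ge]
  · rw [T.anc_of_le]
    linarith

theorem meet_le_ht_geodesic (x y : X) (t : ℝ) : T.meet x y ≤ T.ht (T.geodesic x y t) := by
  rw [geodesic]
  split_ifs with hle <;> rw [ht_anc]
  · exact le_min hle (T.meet_le_left x y)
  · exact le_min (by linarith) (T.meet_le_right x y)

/-- The target jumps from cube to cube, but only where the travel time τ vanishes, and there the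
geodesic is at its starting point whatever the target. Near such a point only finitely many targets
occur. -/
theorem continuous_geodesic_floor {Z : Type*} [TopologicalSpace Z] {d : ℕ} {F : Z → X}
    (hF : Continuous F) {y : Z → Fin d → ℝ} (hy : Continuous y) (p : (Fin d → ℤ) → X) {τ : Z → ℝ}
    (hτ : Continuous τ) (hne : ∀ z, τ z ≠ 0 → ∀ j, Int.fract (y z j) ≠ 0) :
    Continuous fun z => T.geodesic (F z) (p fun j => ⌊y z j⌋) (τ z) := by
  have hg (q : X) : Continuous fun z => T.geodesic (F z) q (τ z) :=
    T.continuous_geodesic.comp ((hF.prodMk continuous_const).prodMk hτ)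
  have hyj (j : Fin d) : Continuous fun z => y z j := (continuous_apply j).comp hy
  rw [continuous_iff_continuousAt]
  intro z₀
  by_cases h0 : τ z₀ = 0
  · rw [ContinuousAt, h0, geodesic_zero]
    intro U hU
    let A : Finset (Fin d → ℤ) := Fintype.piFinset fun j => Finset.Icc (⌊y z₀ j⌋ - 1) (⌊y z₀ j⌋ + 1)
    have h1 : ∀ᶠ z in 𝓝 z₀, (fun j => ⌊y z j⌋) ∈ A := by
      simp only [A, Fintype.mem_piFinset, Finset.mem_Icc]
      refine Filter.eventually_all.2 fun j => ?_
      have a1 := (hyj j).continuousAt.eventually (lt_mem_nhds (sub_one_lt (y z₀ j)))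
      have a2 := (hyj j).continuousAt.eventually (gt_mem_nhds (lt_add_one (y z₀ j)))
      filter_upwards [a1, a2] with z b1 b2
      constructor
      · rw [Int.le_floor]
        push_cast
        linarith [Int.floor_le (y z₀ j)]
      · rw [← Int.lt_add_one_iff, Int.floor_lt]
        push_cast
        linarith [Int.lt_floor_add_one (y z₀ j)]
    have h2 : ∀ᶠ z in 𝓝 z₀, ∀ a ∈ A, T.geodesic (F z) (p a) (τ z) ∈ U := by
      rw [Filter.eventually_all_finset]
      intro a _
      refine ((hg (p a)).tendsto z₀).eventually (p := fun q => q ∈ U) ?_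
      rwa [h0, geodesic_zero]
    exact (h1.and h2).mono fun z hz => hz.2 _ hz.1
  · have h1 : ∀ᶠ z in 𝓝 z₀, (fun j => ⌊y z j⌋) = fun j => ⌊y z₀ j⌋ := by
      have : ∀ᶠ z in 𝓝 z₀, ∀ j, ⌊y z j⌋ = ⌊y z₀ j⌋ := by
        refine Filter.eventually_all.2 fun j => ?_
        have b0 : (⌊y z₀ j⌋ : ℝ) < y z₀ j := by
          have := (Int.fract_nonneg (y z₀ j)).lt_of_ne' (hne z₀ h0 j)
          rw [Int.fract] at this
          linarith
        have a1 := (hyj j).continuousAt.eventually (lt_mem_nhds b0)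
        have a2 := (hyj j).continuousAt.eventually (gt_mem_nhds (Int.lt_floor_add_one (y z₀ j)))
        filter_upwards [a1, a2] with z b1 b2
        exact Int.floor_eq_iff.2 ⟨b1.le, b2⟩
      exact this.mono fun z hz => funext hz
    refine (hg (p fun j => ⌊y z₀ j⌋)).continuousAt.congr (h1.mono fun z hz => ?_)
    simp only [hz]

end Geodesic

end MergeTree

/-! ### Shifted cubical grids -/

/-- A function of `x` that takes the value `1` unless a coordinate of `x` is close to an integer
and vanishes if a coordinate is an integer. -/
def cubeBump (m : ℕ) {d : ℕ} (y : Fin d → ℝ) : ℝ :=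
  ∏ j, min 1 (2 * m * ‖(y j : UnitAddCircle)‖)

theorem continuous_cubeBump (m d : ℕ) : Continuous (cubeBump m : (Fin d → ℝ) → ℝ) := by
  refine continuous_finsetProd _ fun j _ => continuous_const.min (continuous_const.mul ?_)
  exact continuous_norm.comp ((AddCircle.continuous_mk' 1).comp (continuous_apply j))

theorem fract_ne_zero_of_cubeBump_ne_zero {m d : ℕ} {y : Fin d → ℝ} (hy : cubeBump m y ≠ 0)
    (j : Fin d) : Int.fract (y j) ≠ 0 := by
  intro e
  refine hy (Finset.prod_eq_zero (Finset.mem_univ j) ?_)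
  have : (y j : UnitAddCircle) = 0 := by
    rw [← Int.self_sub_floor, sub_eq_zero] at e
    rw [AddCircle.coe_eq_zero_iff]
    exact ⟨⌊y j⌋, by simpa using e.symm⟩
  simp [this]

/-- Pigeonhole principle: the cubes of `m > d` translated grids cover the space. -/
theorem exists_cubeBump_eq_one {m d : ℕ} (hdm : d < m) (y : Fin d → ℝ) :
    ∃ k : Fin m, cubeBump m (fun j => y j - (k : ℝ) / m) = 1 := by
  have hm : (0 : ℝ) < m := by exact_mod_cast (Nat.zero_le d).trans_lt hdm
  by_contra! hne
  have hbad (k : Fin m) : ∃ j : Fin d, 2 * m * ‖((y j - (k : ℝ) / m : ℝ) : UnitAddCircle)‖ < 1 := by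
    by_contra! hle
    exact hne k (Finset.prod_eq_one fun j _ => min_eq_left (hle j))
  choose j hj using hbad
  -- If every grid had a wall closer than 1 / (2m) to y, then two grids would have it in the same
  -- coordinate direction. Their shifts k / m and l / m would differ by less than 1 / m modulo 1,
  -- which is impossible for k ≠ l.
  obtain ⟨k, l, hkl, e⟩ := Fintype.exists_ne_map_eq_of_card_lt j (by simpa using hdm)
  have h1 := hj k
  have h2 := hj l
  rw [← e] at h2
  have h3 : ‖(((l : ℝ) / m - (k : ℝ) / m : ℝ) : UnitAddCircle)‖ < 1 / m := by
    have := norm_sub_le ((y (j k) - (k : ℝ) / m : ℝ) : UnitAddCircle)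
      ((y (j k) - (l : ℝ) / m : ℝ) : UnitAddCircle)
    rw [← AddCircle.coe_sub, sub_sub_sub_cancel_left] at this
    rw [lt_div_iff₀ hm]
    nlinarith
  rw [UnitAddCircle.norm_eq] at h3
  set n := round ((l : ℝ) / m - (k : ℝ) / m)
  have h4 : |((l : ℤ) - (k : ℤ) - n * m : ℤ)| < (1 : ℤ) := by
    have : |(((l : ℤ) - (k : ℤ) - n * m : ℤ) : ℝ)| < 1 := by
      have e : (((l : ℤ) - (k : ℤ) - n * m : ℤ) : ℝ) = ((l : ℝ) / m - (k : ℝ) / m - n) * m := by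
        push_cast
        field_simp
      rw [e, abs_mul, abs_of_pos hm]
      rwa [lt_div_iff₀ hm] at h3
    exact_mod_cast this
  rw [Int.abs_lt_one_iff] at h4
  have h5 : ((l : ℕ) : ℤ) ≡ ((k : ℕ) : ℤ) [ZMOD m] :=
    (Int.modEq_iff_dvd.2 ⟨n, by linarith⟩ : ((k : ℕ) : ℤ) ≡ ((l : ℕ) : ℤ) [ZMOD m]).symm
  have h6 := Nat.ModEq.eq_of_lt_of_lt ((Int.natCast_modEq_iff).1 h5) l.2 k.2
  exact hkl (Fin.ext h6.symm)

theorem continuous_clamp : Continuous fun t : ℝ => max 0 (min 1 t) :=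
  continuous_const.max (continuous_const.min continuous_id)

/-! ### Filling spheres in superlevel sets and slabs -/

section Extension

variable {m d : ℕ} {X : Fin m → Type u} [∀ i, TopologicalSpace (X i)] (T : ∀ i, MergeTree (X i))

-- The product of trees contracts along geodesics to x₀, so f is coned off radially, without control
-- of heights. The norm is the sup norm, hence the sphere is the boundary of a cube.
include T in
theorem exists_continuous_extension (x₀ : ∀ i, X i) {f : (Fin d → ℝ) → ∀ i, X i}
    (hf : ContinuousOn f (Metric.sphere 0 1)) :
    ∃ F : (Fin d → ℝ) → ∀ i, X i, Continuous F ∧ ∀ x ∈ Metric.sphere 0 1, F x = f x := by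
  classical
  refine ⟨fun x => if ‖x‖ ≤ 1 / 2 then x₀ else fun i => (T i).geodesic (f (‖x‖⁻¹ • x) i) (x₀ i)
    (max 0 (min 1 (2 - 2 * ‖x‖))), ?_, ?_⟩
  · refine continuous_if ?_ continuousOn_const ?_
    · intro x hx
      have e : ‖x‖ = 1 / 2 := frontier_le_subset_eq continuous_norm continuous_const hx
      funext i
      rw [e]
      norm_num
      rw [(T i).geodesic_one]
    · have hsub : closure {x : Fin d → ℝ | ¬ ‖x‖ ≤ 1 / 2} ⊆ {x | 1 / 2 ≤ ‖x‖} :=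
        closure_minimal (fun x hx => (not_le.1 hx).le) (isClosed_le continuous_const continuous_norm)
      refine ContinuousOn.mono ?_ hsub
      have hpos : ∀ x ∈ {x : Fin d → ℝ | 1 / 2 ≤ ‖x‖}, ‖x‖ ≠ 0 := fun x (hx : 1 / 2 ≤ ‖x‖) => by
        linarith
      have hn : ContinuousOn (fun x : Fin d → ℝ => ‖x‖⁻¹ • x) {x | 1 / 2 ≤ ‖x‖} :=
        (continuous_norm.continuousOn.inv₀ hpos).smul continuousOn_id
      have hfn : ContinuousOn (fun x : Fin d → ℝ => f (‖x‖⁻¹ • x)) {x | 1 / 2 ≤ ‖x‖} := by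
        refine hf.comp hn fun x hx => ?_
        simp [norm_smul, hpos x hx]
      refine continuousOn_pi.2 fun i => ?_
      refine (T i).continuous_geodesic.comp_continuousOn (ContinuousOn.prodMk
        (ContinuousOn.prodMk ((continuous_apply i).comp_continuousOn hfn) continuousOn_const) ?_)
      exact (continuous_clamp.comp (continuous_const.sub
        (continuous_const.mul continuous_norm))).continuousOn
  · intro x hx
    have e : ‖x‖ = 1 := by simpa using hx
    funext i
    simp only [e]
    norm_num
    rw [(T i).geodesic_zero]

/-- Either no coordinate of F x₀ gains height by rising; then nearby points rise to or above F x₀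
and merge no lower than it. Or some coordinate gains height, the sum at x₀ exceeds a strictly, and
continuity suffices. Without rising, the bound a could be missed by a small amount. Each factor has
its own displacement since each uses its own grid. -/
theorem eventually_le_sum_meet_rise {a : ℝ} {F : (Fin d → ℝ) → ∀ i, X i} (hF : Continuous F)
    {x₀ : Fin d → ℝ} (ha : a ≤ ∑ i, (T i).ht (F x₀ i)) :
    ∀ᶠ p : (Fin m → Fin d → ℝ) × (Fin d → ℝ) in 𝓝 (0, x₀),
      a ≤ ∑ i, (T i).meet ((T i).rise 1 (F p.2 i)) ((T i).rise 1 (F (p.2 + p.1 i) i)) := by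
  have hFi (i : Fin m) : Continuous fun p : (Fin m → Fin d → ℝ) × (Fin d → ℝ) => F p.2 i :=
    (continuous_apply i).comp (hF.comp continuous_snd)
  have hFi' (i : Fin m) :
      Continuous fun p : (Fin m → Fin d → ℝ) × (Fin d → ℝ) => F (p.2 + p.1 i) i :=
    (continuous_apply i).comp (hF.comp (continuous_snd.add
      ((continuous_apply i).comp continuous_fst)))
  have hrise (i : Fin m) : ∀ x, (T i).ht (F x i) ≤ (T i).ht ((T i).rise 1 (F x i)) :=
    fun x => (T i).le_ht_rise _ _
  have hr (i : Fin m) : Continuous ((T i).rise 1) :=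
    (T i).continuous_rise.comp (continuous_const.prodMk continuous_id)
  by_cases heq : ∀ i, (T i).ht ((T i).rise 1 (F x₀ i)) = (T i).ht (F x₀ i)
  · have h1 (i : Fin m) : ∀ᶠ p : (Fin m → Fin d → ℝ) × (Fin d → ℝ) in 𝓝 (0, x₀),
        (T i).meet ((T i).rise 1 (F p.2 i)) (F x₀ i) = (T i).ht (F x₀ i) :=
      (hFi i).continuousAt.eventually ((T i).eventually_meet_rise (heq i))
    have h2 (i : Fin m) : ∀ᶠ p : (Fin m → Fin d → ℝ) × (Fin d → ℝ) in 𝓝 (0, x₀),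
        (T i).meet ((T i).rise 1 (F (p.2 + p.1 i) i)) (F x₀ i) = (T i).ht (F x₀ i) := by
      refine ((hFi' i).tendsto (0, x₀)).eventually
        (p := fun q => (T i).meet ((T i).rise 1 q) (F x₀ i) = (T i).ht (F x₀ i)) ?_
      simpa using (T i).eventually_meet_rise (heq i)
    filter_upwards [Filter.eventually_all.2 h1, Filter.eventually_all.2 h2] with p b1 b2
    refine ha.trans (Finset.sum_le_sum fun i _ => ?_)
    have := (T i).min_meet_le ((T i).rise 1 (F p.2 i)) (F x₀ i)
      ((T i).rise 1 (F (p.2 + p.1 i) i))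
    rwa [b1 i, (T i).meet_comm (F x₀ i), b2 i, min_self] at this
  · push Not at heq
    obtain ⟨i₀, hi₀⟩ := heq
    have hlt : a < ∑ i, (T i).ht ((T i).rise 1 (F x₀ i)) :=
      ha.trans_lt (Finset.sum_lt_sum (fun i _ => hrise i x₀)
        ⟨i₀, Finset.mem_univ _, (hrise i₀ x₀).lt_of_ne hi₀.symm⟩)
    have hc : Continuous fun p : (Fin m → Fin d → ℝ) × (Fin d → ℝ) =>
        ∑ i, (T i).meet ((T i).rise 1 (F p.2 i)) ((T i).rise 1 (F (p.2 + p.1 i) i)) :=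
      continuous_finsetSum _ fun i _ => (T i).continuous_meet.comp
        (((hr i).comp (hFi i)).prodMk ((hr i).comp (hFi' i)))
    refine (hc.continuousAt.eventually (lt_mem_nhds ?_)).mono fun p hp => le_of_lt hp
    simpa [(T _).meet_self] using hlt

/-- Maps of spheres of dimension less than `m - 1` into a superlevel set in a product of `m` trees
extend to the ball. -/
theorem exists_extension_superlevel (hdm : d < m) (x₀ : ∀ i, X i) {a : ℝ}
    {f : (Fin d → ℝ) → ∀ i, X i} (hf : ContinuousOn f (Metric.sphere 0 1))
    (ha : ∀ x ∈ Metric.sphere (0 : Fin d → ℝ) 1, a ≤ ∑ i, (T i).ht (f x i)) :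
    ∃ E : (Fin d → ℝ) → ∀ i, X i, Continuous E ∧ (∀ x ∈ Metric.sphere 0 1, E x = f x) ∧
      ∀ x, a ≤ ∑ i, (T i).ht (E x i) := by
  obtain ⟨F, hF, hFf⟩ := exists_continuous_extension T x₀ hf
  have hFi (i : Fin m) : Continuous fun x => F x i := (continuous_apply i).comp hF
  -- Compactness of the sphere makes the admissible displacement uniform.
  obtain ⟨δ, hδ, hmeet⟩ : ∃ δ > 0, ∀ v : Fin m → Fin d → ℝ, ‖v‖ < δ →
      ∀ x ∈ Metric.sphere (0 : Fin d → ℝ) 1,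
      a ≤ ∑ i, (T i).meet ((T i).rise 1 (F x i)) ((T i).rise 1 (F (x + v i) i)) := by
    have := (isCompact_sphere (0 : Fin d → ℝ) 1).eventually_forall_of_forall_eventually
      (x₀ := (0 : Fin m → Fin d → ℝ)) (P := fun v x =>
        a ≤ ∑ i, (T i).meet ((T i).rise 1 (F x i)) ((T i).rise 1 (F (x + v i) i)))
      fun x hx => eventually_le_sum_meet_rise T hF (by rw [hFf x hx]; exact ha x hx)
    obtain ⟨δ, hδ, hv⟩ := Metric.eventually_nhds_iff.1 this
    exact ⟨δ, hδ, fun v hv' => hv (by simpa using hv')⟩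
  -- Radius 2, because sample points for the unit ball are at distance at most 1 / N ≤ 1 from it.
  have hlow (i : Fin m) : ∃ c, ∀ x ∈ Metric.closedBall (0 : Fin d → ℝ) 2,
      ∀ y ∈ Metric.closedBall (0 : Fin d → ℝ) 2,
      c ≤ (T i).meet ((T i).rise 1 (F x i)) ((T i).rise 1 (F y i)) := by
    have hr : Continuous fun x => (T i).rise 1 (F x i) :=
      (T i).continuous_rise.comp (continuous_const.prodMk (hFi i))
    have hc : Continuous fun p : (Fin d → ℝ) × (Fin d → ℝ) =>
        (T i).meet ((T i).rise 1 (F p.1 i)) ((T i).rise 1 (F p.2 i)) :=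
      (T i).continuous_meet.comp ((hr.comp continuous_fst).prodMk (hr.comp continuous_snd))
    obtain ⟨c, hc⟩ := (((isCompact_closedBall (0 : Fin d → ℝ) 2).prod
      (isCompact_closedBall (0 : Fin d → ℝ) 2)).image hc).bddBelow
    exact ⟨c, fun x hx y hy => hc ⟨(x, y), ⟨hx, hy⟩, rfl⟩⟩
  choose c hc using hlow
  obtain ⟨N, hN⟩ : ∃ N : ℝ, N = max 1 (2 / δ) := ⟨_, rfl⟩
  have hN1 : 1 ≤ N := hN ▸ le_max_left _ _
  have hNδ : 1 / N < δ := by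
    have : 2 / δ ≤ N := hN ▸ le_max_right _ _
    rw [div_le_iff₀ hδ] at this
    rw [div_lt_iff₀ (by linarith)]
    linarith
  -- `y i` are coordinates in the i-th grid, of mesh 1 / N and shifted in proportion to i / m; `s i
  -- z` is the lower corner of the cube z, where F is sampled.
  let y (i : Fin m) (x : Fin d → ℝ) : Fin d → ℝ := fun j => N * x j - (i : ℝ) / m
  let s (i : Fin m) (z : Fin d → ℤ) : Fin d → ℝ := fun j => ((z j : ℝ) + (i : ℝ) / m) / N
  have hs (i : Fin m) (x : Fin d → ℝ) : ‖s i (fun j => ⌊y i x j⌋) - x‖ ≤ 1 / N := by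
    have hN0 : 0 < N := by linarith
    refine (pi_norm_le_iff_of_nonneg (by positivity)).2 fun j => ?_
    have h1 := Int.floor_le (y i x j)
    have h2 := Int.lt_floor_add_one (y i x j)
    have e : (s i (fun j => ⌊y i x j⌋) - x) j = -((y i x j - ⌊y i x j⌋) / N) := by
      simp only [s, y, Pi.sub_apply]
      field_simp
      ring
    rw [e, norm_neg, Real.norm_eq_abs, abs_of_nonneg (div_nonneg (by linarith) hN0.le)]
    exact div_le_div_of_nonneg_right (by linarith) hN0.le
  -- The target of a cube lies above the risen sample, so on the way to it a coordinate never drops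
  -- below its merging height with that sample. The height a + ∑ |c i| makes up for the worst case
  -- in the other factors.
  choose p hp hpm using fun (i : Fin m) (z : Fin d → ℤ) =>
    (T i).exists_above ((T i).rise 1 (F (s i z) i)) (a + ∑ i, |c i|)
  let pr (x : Fin d → ℝ) : Fin d → ℝ := (max 1 ‖x‖)⁻¹ • x
  have hpr : Continuous pr := by
    refine Continuous.smul (Continuous.inv₀ (continuous_const.max continuous_norm) fun x => ?_)
      continuous_id
    exact (zero_lt_one.trans_le (le_max_left _ _)).ne'
  have hpr_norm (x : Fin d → ℝ) : ‖pr x‖ = (max 1 ‖x‖)⁻¹ * ‖x‖ := by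
    rw [norm_smul, norm_inv, Real.norm_of_nonneg (zero_le_one.trans (le_max_left _ _))]
  -- For ‖x‖ between 3 and 2 the point rises over the sphere, between 2 and 1 the motion towards the
  -- targets is switched on over the sphere, and in the unit ball it acts on F at full strength.
  let E (x : Fin d → ℝ) (i : Fin m) : X i :=
    (T i).geodesic ((T i).rise (max 0 (min 1 (3 - ‖x‖))) (F (pr x) i))
      (p i fun j => ⌊y i (pr x) j⌋) (max 0 (min 1 (2 - ‖x‖)) * cubeBump m (y i (pr x)))
  have hE : Continuous E := by
    refine continuous_pi fun i => ?_
    have hy : Continuous fun x => y i (pr x) := continuous_pi fun j =>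
      (continuous_const.mul ((continuous_apply j).comp hpr)).sub continuous_const
    refine (T i).continuous_geodesic_floor ?_ hy (p i) ?_ fun x hx j =>
      fract_ne_zero_of_cubeBump_ne_zero (right_ne_zero_of_mul hx) j
    · exact (T i).continuous_rise.comp ((continuous_clamp.comp
        (continuous_const.sub continuous_norm)).prodMk ((hFi i).comp hpr))
    · exact (continuous_clamp.comp (continuous_const.sub continuous_norm)).mul
        ((continuous_cubeBump m d).comp hy)
  have hEa (x : Fin d → ℝ) : a ≤ ∑ i, (T i).ht (E x i) := by
    have hmle (i : Fin m) (r : ℝ) :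
        (T i).meet ((T i).rise r (F (pr x) i))
          ((T i).rise 1 (F (s i fun j => ⌊y i (pr x) j⌋) i)) ≤
        (T i).meet ((T i).rise r (F (pr x) i)) (p i fun j => ⌊y i (pr x) j⌋) := by
      have := (T i).min_meet_le ((T i).rise r (F (pr x) i))
        ((T i).rise 1 (F (s i fun j => ⌊y i (pr x) j⌋) i)) (p i fun j => ⌊y i (pr x) j⌋)
      rwa [hpm, min_eq_left ((T i).meet_le_right _ _)] at this
    rcases le_or_gt 2 ‖x‖ with h2 | h2
    · have hx1 : pr x ∈ Metric.sphere (0 : Fin d → ℝ) 1 := by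
        rw [mem_sphere_zero_iff_norm, hpr_norm, max_eq_right (by linarith),
          inv_mul_cancel₀ (by linarith)]
      refine (ha _ hx1).trans (Finset.sum_le_sum fun i _ => ?_)
      simp only [E]
      rw [max_eq_left (a := (0 : ℝ)) (b := min 1 (2 - ‖x‖)) ((min_le_right _ _).trans (by linarith)),
        zero_mul, (T i).geodesic_zero, ← hFf _ hx1]
      exact (T i).le_ht_rise _ _
    have e3 : max 0 (min 1 (3 - ‖x‖)) = 1 := by
      rw [min_eq_left (by linarith), max_eq_right zero_le_one]
    have hge (i : Fin m) : (T i).meet ((T i).rise 1 (F (pr x) i))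
          ((T i).rise 1 (F (s i fun j => ⌊y i (pr x) j⌋) i)) ≤ (T i).ht (E x i) := by
      refine (hmle i 1).trans ?_
      simp only [E, e3]
      exact (T i).meet_le_ht_geodesic _ _ _
    rcases le_or_gt 1 ‖x‖ with h1 | h1
    · have hx1 : pr x ∈ Metric.sphere (0 : Fin d → ℝ) 1 := by
        rw [mem_sphere_zero_iff_norm, hpr_norm, max_eq_right (by linarith),
          inv_mul_cancel₀ (by linarith)]
      have := hmeet (fun i => s i (fun j => ⌊y i (pr x) j⌋) - pr x)
        ((pi_norm_le_iff_of_nonneg (by positivity)).2 (fun i => hs i (pr x)) |>.trans_lt hNδ)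
        (pr x) hx1
      simp only [add_sub_cancel] at this
      exact this.trans (Finset.sum_le_sum fun i _ => hge i)
    · have ex : pr x = x := by
        simp only [pr]
        rw [max_eq_left h1.le, inv_one, one_smul]
      -- Inside the ball some factor k has arrived at its target; all others are bounded below by `c
      -- i`.
      obtain ⟨k, hk⟩ := exists_cubeBump_eq_one hdm fun j => N * x j
      have hEk : E x k = p k fun j => ⌊y k (pr x) j⌋ := by
        have : cubeBump m (y k (pr x)) = 1 := by rw [ex]; exact hk
        simp only [E]
        rw [this, min_eq_left (b := 2 - ‖x‖) (by linarith), max_eq_right zero_le_one, mul_one,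
          (T k).geodesic_one]
      have hci (i : Fin m) : c i ≤ (T i).ht (E x i) := by
        refine (hc i _ ?_ _ ?_).trans (hge i)
        · rw [mem_closedBall_zero_iff, ex]
          linarith
        · rw [mem_closedBall_zero_iff]
          have a1 := hs i (pr x)
          have a2 : 1 / N ≤ 1 := by
            rw [div_le_one (by linarith)]
            exact hN1
          have a3 := norm_add_le (s i (fun j => ⌊y i (pr x) j⌋) - pr x) (pr x)
          rw [sub_add_cancel] at a3
          rw [← ex] at h1
          linarith
      rw [← Finset.add_sum_erase _ _ (Finset.mem_univ k), hEk]
      have h5 := hp k fun j => ⌊y k (pr x) j⌋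
      have h6 : ∑ i ∈ Finset.univ.erase k, c i ≤ ∑ i ∈ Finset.univ.erase k, (T i).ht (E x i) :=
        Finset.sum_le_sum fun i _ => hci i
      have h7 : -∑ i, |c i| ≤ ∑ i ∈ Finset.univ.erase k, c i := by
        have h8 : ∑ i ∈ Finset.univ.erase k, |c i| ≤ ∑ i, |c i| :=
          Finset.sum_le_sum_of_subset_of_nonneg (Finset.erase_subset _ _) fun i _ _ => abs_nonneg _
        have h9 : -∑ i ∈ Finset.univ.erase k, |c i| ≤ ∑ i ∈ Finset.univ.erase k, c i := by
          rw [← Finset.sum_neg_distrib]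
          exact Finset.sum_le_sum fun i _ => neg_abs_le _
        linarith
      linarith
  refine ⟨fun x => E ((3 : ℝ) • x), hE.comp (continuous_const_smul _), fun x hx => ?_,
    fun x => hEa _⟩
  have hx1 : ‖x‖ = 1 := by simpa using hx
  have h3 : ‖(3 : ℝ) • x‖ = 3 := by rw [norm_smul, hx1]; norm_num
  have ex : pr ((3 : ℝ) • x) = x := by
    simp only [pr]
    rw [h3, smul_smul]
    norm_num
  funext i
  simp only [E]
  rw [ex, h3]
  norm_num
  rw [(T i).geodesic_zero, (T i).rise_zero, hFf x hx]

/-- Maps of spheres of dimension less than `m - 1` into the preimage of a compact interval in a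
product of `m` trees extend to the ball. -/
theorem exists_extension_slab (hdm : d < m) (x₀ : ∀ i, X i) {a b : ℝ} (hab : a ≤ b)
    {f : (Fin d → ℝ) → ∀ i, X i} (hf : ContinuousOn f (Metric.sphere 0 1))
    (hfI : ∀ x ∈ Metric.sphere (0 : Fin d → ℝ) 1, ∑ i, (T i).ht (f x i) ∈ Set.Icc a b) :
    ∃ E : (Fin d → ℝ) → ∀ i, X i, Continuous E ∧ (∀ x ∈ Metric.sphere 0 1, E x = f x) ∧
      ∀ x, ∑ i, (T i).ht (E x i) ∈ Set.Icc a b := by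
  obtain ⟨E, hE, hEf, hEa⟩ := exists_extension_superlevel T hdm x₀ hf fun x hx => (hfI x hx).1
  have hm : (0 : ℝ) < m := by exact_mod_cast (Nat.zero_le d).trans_lt hdm
  have hEi (i : Fin m) : Continuous fun x => E x i := (continuous_apply i).comp hE
  have hh (i : Fin m) : Continuous fun x => (T i).ht (E x i) := (T i).continuous_ht.comp (hEi i)
  -- The excess over b is shared equally by the m factors, so that the total height becomes its
  -- minimum with b.
  let s (x : Fin d → ℝ) : ℝ := max 0 (∑ i, (T i).ht (E x i) - b) / m
  have hs : Continuous s := (continuous_const.max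
    ((continuous_finsetSum _ fun i _ => hh i).sub continuous_const)).div_const _
  have hs0 (x) : 0 ≤ s x := div_nonneg (le_max_left _ _) hm.le
  refine ⟨fun x i => (T i).anc (E x i) ((T i).ht (E x i) - s x), ?_, fun x hx => ?_, fun x => ?_⟩
  · exact continuous_pi fun i => (T i).continuous_anc.comp ((hEi i).prodMk ((hh i).sub hs))
  · have : s x = 0 := by
      simp only [s]
      rw [hEf x hx, max_eq_left (by linarith [(hfI x hx).2]), zero_div]
    funext i
    simp only [this, sub_zero, (T i).anc_of_le le_rfl, hEf x hx]
  · have e (i : Fin m) : (T i).ht ((T i).anc (E x i) ((T i).ht (E x i) - s x)) =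
        (T i).ht (E x i) - s x := by
      rw [(T i).ht_anc, min_eq_left (by linarith [hs0 x])]
    simp only [e, Finset.sum_sub_distrib, Finset.sum_const, Finset.card_univ, Fintype.card_fin,
      nsmul_eq_mul]
    have e2 : (m : ℝ) * s x = max 0 (∑ i, (T i).ht (E x i) - b) := mul_div_cancel₀ _ hm.ne'
    rw [e2]
    have := hEa x
    rcases max_cases 0 (∑ i, (T i).ht (E x i) - b) with ⟨h1, h2⟩ | ⟨h1, h2⟩ <;> rw [h1] <;>
      constructor <;> linarith

end Extension

/-! ### From extensions to homotopy groups -/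

/-- If maps from the boundary of the `(n + 1)`-dimensional cube extend to the cube, then the
`n`-th homotopy group is trivial. -/
theorem subsingleton_homotopyGroup_of_extension {X : Type*} [TopologicalSpace X] {n : ℕ}
    (hext : ∀ g : (Fin (n + 1) → ℝ) → X, ContinuousOn g (Metric.sphere 0 1) →
      ∃ E : (Fin (n + 1) → ℝ) → X, Continuous E ∧ ∀ x ∈ Metric.sphere 0 1, E x = g x) (x : X) :
    Subsingleton (π_ n X x) := by
  classical
  suffices key : ∀ f : GenLoop (Fin n) X x, GenLoop.Homotopic f GenLoop.const by
    refine ⟨fun a b => ?_⟩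
    induction a using Quotient.inductionOn with | _ a
    induction b using Quotient.inductionOn with | _ b
    exact Quotient.sound ((key a).trans (key b).symm)
  intro f
  let pr (z : Fin (n + 1) → ℝ) : Fin n → unitInterval := fun j =>
    Set.projIcc 0 1 zero_le_one ((z j.succ + 1) / 2)
  have hpr : Continuous pr := continuous_pi fun j => continuous_projIcc.comp
    (((continuous_apply j.succ).add continuous_const).div_const 2)
  -- On the boundary of [-1, 1]^(n+1) this is f on the face z 0 = -1 and constant on the other
  -- faces. An extension to the cube is a null homotopy of f relative to the boundary.
  let g (z : Fin (n + 1) → ℝ) : X := if z 0 = -1 then f (pr z) else x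
  have hgA : ∀ z, z 0 = -1 → g z = f (pr z) := fun z hz => if_pos hz
  have hgB : ∀ z, (z 0 = 1 ∨ ∃ j : Fin n, |z j.succ| = 1) → g z = x := by
    intro z hz
    simp only [g]
    split_ifs with h0
    · rcases hz with hz | ⟨j, hj⟩
      · norm_num [hz] at h0
      · refine GenLoop.boundary f _ ⟨j, ?_⟩
        rcases eq_or_eq_neg_of_abs_eq hj with e | e
        · right
          simp [pr, e]
        · left
          simp [pr, e]
    · rfl
  have hsub : Metric.sphere (0 : Fin (n + 1) → ℝ) 1 ⊆
      {z | z 0 = -1} ∪ {z | z 0 = 1 ∨ ∃ j : Fin n, |z j.succ| = 1} := by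
    intro z hz
    have hz1 : ‖z‖ = 1 := by simpa using hz
    obtain ⟨i, hi⟩ : ∃ i, ‖z i‖ = ‖z‖ := by
      obtain ⟨i, -, hi⟩ := Finset.exists_mem_eq_sup Finset.univ Finset.univ_nonempty fun i => ‖z i‖₊
      refine ⟨i, ?_⟩
      rw [Pi.norm_def, hi]
      rfl
    rw [hz1, Real.norm_eq_abs] at hi
    rcases Fin.eq_zero_or_eq_succ i with rfl | ⟨j, rfl⟩
    · rcases eq_or_eq_neg_of_abs_eq hi with e | e
      · exact Or.inr (Or.inl e)
      · exact Or.inl e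
    · exact Or.inr (Or.inr ⟨j, hi⟩)
  have hg : ContinuousOn g (Metric.sphere 0 1) := by
    refine ContinuousOn.mono (ContinuousOn.union_of_isClosed ?_ ?_ ?_ ?_) hsub
    · exact (f.1.continuous.comp hpr).continuousOn.congr hgA
    · exact continuousOn_const.congr hgB
    · exact isClosed_eq (continuous_apply 0) continuous_const
    · have : {z : Fin (n + 1) → ℝ | z 0 = 1 ∨ ∃ j : Fin n, |z j.succ| = 1} =
          {z | z 0 = 1} ∪ ⋃ j : Fin n, {z | |z j.succ| = 1} := by
        ext z
        simp
      rw [this]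
      exact (isClosed_eq (continuous_apply 0) continuous_const).union
        (isClosed_iUnion_of_finite fun j =>
          isClosed_eq (continuous_abs.comp (continuous_apply j.succ)) continuous_const)
  obtain ⟨E, hE, hEg⟩ := hext g hg
  let c (t : unitInterval) (y : Fin n → unitInterval) : Fin (n + 1) → ℝ :=
    Fin.cons (2 * (t : ℝ) - 1) fun j => 2 * (y j : ℝ) - 1
  have hc : Continuous fun p : unitInterval × (Fin n → unitInterval) => c p.1 p.2 := by
    refine continuous_pi fun i => ?_
    rcases Fin.eq_zero_or_eq_succ i with rfl | ⟨j, rfl⟩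
    · simp only [c, Fin.cons_zero]
      fun_prop
    · simp only [c, Fin.cons_succ]
      fun_prop
  have habs (t : unitInterval) : |2 * (t : ℝ) - 1| ≤ 1 := by
    rw [abs_le]
    constructor <;> linarith [t.2.1, t.2.2]
  have hcle (t y) : ‖c t y‖ ≤ 1 := by
    refine (pi_norm_le_iff_of_nonneg zero_le_one).2 fun i => ?_
    rcases Fin.eq_zero_or_eq_succ i with rfl | ⟨j, rfl⟩
    · exact habs t
    · exact habs (y j)
  have hcs (t y) (i) (hi : |c t y i| = 1) : c t y ∈ Metric.sphere (0 : Fin (n + 1) → ℝ) 1 := by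
    rw [mem_sphere_zero_iff_norm]
    exact le_antisymm (hcle t y) (hi ▸ norm_le_pi_norm (c t y) i)
  have hprc (t y) : pr (c t y) = y := by
    funext j
    simp only [pr, c, Fin.cons_succ, sub_add_cancel]
    rw [mul_div_cancel_left₀ _ two_ne_zero, Set.projIcc_val]
  have h0 (y) : E (c 0 y) = f y := by
    have e : c 0 y 0 = -1 := by simp [c]
    rw [hEg _ (hcs 0 y 0 (by simp [e])), hgA _ e, hprc]
  have h1 (y) : E (c 1 y) = x := by
    have e : c 1 y 0 = 1 := by simp [c]; norm_num
    rw [hEg _ (hcs 1 y 0 (by simp [e])), hgB _ (Or.inl e)]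
  have hb (t) (y) (hy : y ∈ Cube.boundary (Fin n)) : E (c t y) = x := by
    obtain ⟨j, hj⟩ := hy
    have e : |c t y j.succ| = 1 := by
      rcases hj with hj | hj
      · simp [c, hj]
      · simp [c, hj]
        norm_num
    rw [hEg _ (hcs t y _ e), hgB _ (Or.inr ⟨j, e⟩)]
  refine ⟨⟨⟨⟨fun p => E (c p.1 p.2), hE.comp hc⟩, fun y => h0 y, fun y => h1 y⟩, ?_⟩⟩
  intro t y hy
  exact (hb t y hy).trans (GenLoop.boundary f y hy).symm

section

variable {m : ℕ} {V : Fin m → Type u} {G : ∀ i, SimpleGraph (V i)} {h : ∀ i, V i → ℝ}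

theorem MergeTree.exists_ht_eq {X : Type u} [TopologicalSpace X] (T : MergeTree X) (r : ℝ) :
    ∃ x, T.ht x = r := by
  obtain ⟨v, -, hv⟩ := T.exists_branch r
  obtain ⟨p, -, hp, -⟩ := hv r
  exact ⟨T.anc p r, by rw [T.ht_anc, min_eq_left hp]⟩

/-- Triviality of the n-th homotopy group needs fillings by balls of dimension n + 1, and n ≤ m - 2
means n + 1 < m. For nonemptiness, every coordinate is put at height a / m. -/
theorem isHomotopyConnected_heightPreimage (hm : 1 ≤ m) (T : ∀ i, MergeTree (Realization (G i)))
    (hT : ∀ i x, (T i).ht x = affineHeight (h i) x) {a b : ℝ} (hab : a ≤ b) :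
    IsHomotopyConnected ((m : ℤ) - 2) (heightPreimage G h (Set.Icc a b)) := by
  have hmem (x : ∀ i, Realization (G i)) :
      x ∈ heightPreimage G h (Set.Icc a b) ↔ ∑ i, (T i).ht (x i) ∈ Set.Icc a b := by
    simp only [hT]
    rfl
  refine ⟨fun _ => ?_, fun n hn x => ?_⟩
  · choose x hx using fun i => (T i).exists_ht_eq (a / m)
    refine ⟨⟨x, (hmem x).2 ?_⟩⟩
    have hm0 : (m : ℝ) ≠ 0 := by positivity
    simp only [hx, Finset.sum_const, Finset.card_univ, Fintype.card_fin, nsmul_eq_mul]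
    rw [mul_div_cancel₀ _ hm0]
    exact ⟨le_rfl, hab⟩
  · refine subsingleton_homotopyGroup_of_extension (fun g hg => ?_) x
    obtain ⟨E, hE, hEg, hEI⟩ := exists_extension_slab T (d := n + 1) (by omega) x.1 hab
      (continuous_subtype_val.comp_continuousOn hg) fun z _ => (hmem _).1 (g z).2
    exact ⟨fun z => ⟨E z, (hmem _).2 (hEI z)⟩, hE.subtype_mk _,
      fun z hz => Subtype.ext (hEg z hz)⟩

end

/-! ### Augmented chains of tuples: degree n consists of n-tuples -/

namespace TupleChain

section Algebra

variable {K K' : Type*}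

/-- The alternating sum of the faces of tuples of points. -/
def bd (n : ℕ) : ((Fin (n + 1) → K) →₀ ℤ) →ₗ[ℤ] ((Fin n → K) →₀ ℤ) :=
  Finsupp.linearCombination ℤ fun x =>
    ∑ i : Fin (n + 1), (-1 : ℤ) ^ (i : ℕ) • Finsupp.single (x ∘ i.succAbove) 1

theorem bd_single {n : ℕ} (x : Fin (n + 1) → K) : bd n (Finsupp.single x 1) =
    ∑ i : Fin (n + 1), (-1 : ℤ) ^ (i : ℕ) • Finsupp.single (x ∘ i.succAbove) 1 := by
  simp [bd]

/-- The cone with a given apex. -/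
def cone (b : K) (n : ℕ) : ((Fin n → K) →₀ ℤ) →ₗ[ℤ] ((Fin (n + 1) → K) →₀ ℤ) :=
  Finsupp.lmapDomain ℤ ℤ fun x => Fin.cons b x

theorem cone_single (b : K) {n : ℕ} (x : Fin n → K) :
    cone b n (Finsupp.single x 1) = Finsupp.single (Fin.cons b x) 1 := by
  simp [cone]

/-- The map induced by a function on tuples. -/
def map (φ : K → K') (n : ℕ) : ((Fin n → K) →₀ ℤ) →ₗ[ℤ] ((Fin n → K') →₀ ℤ) :=
  Finsupp.lmapDomain ℤ ℤ fun x => φ ∘ x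

theorem map_single (φ : K → K') {n : ℕ} (x : Fin n → K) :
    map φ n (Finsupp.single x 1) = Finsupp.single (φ ∘ x) 1 := by
  simp [map]

theorem bd_cone_zero (b : K) (c : (Fin 0 → K) →₀ ℤ) : bd 0 (cone b 0 c) = c := by
  suffices (bd 0).comp (cone b 0) = LinearMap.id from LinearMap.congr_fun this c
  refine Finsupp.lhom_ext' fun x => LinearMap.ext_ring ?_
  simp only [LinearMap.comp_apply, Finsupp.lsingle_apply, cone_single, bd_single, LinearMap.id_apply]
  rw [Fin.sum_univ_one]
  simp only [Fin.val_zero, pow_zero, one_smul]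
  congr 1

/-- Omitting the apex returns c; omitting another point gives a cone over a face, with the sign
shifted by one. -/
theorem bd_cone_succ (b : K) {n : ℕ} (c : (Fin (n + 1) → K) →₀ ℤ) :
    bd (n + 1) (cone b (n + 1) c) = c - cone b n (bd n c) := by
  suffices (bd (n + 1)).comp (cone b (n + 1)) = LinearMap.id - (cone b n).comp (bd n) from
    LinearMap.congr_fun this c
  refine Finsupp.lhom_ext' fun x => LinearMap.ext_ring ?_
  simp only [LinearMap.comp_apply, Finsupp.lsingle_apply, cone_single, bd_single,
    LinearMap.sub_apply, LinearMap.id_apply, map_sum, map_smul]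
  rw [Fin.sum_univ_succ, sub_eq_add_neg, ← Finset.sum_neg_distrib]
  congr 1
  · simp only [Fin.val_zero, pow_zero, one_smul]
    congr 1
  · refine Finset.sum_congr rfl fun i _ => ?_
    rw [Fin.val_succ, pow_succ, mul_neg_one, neg_smul]
    congr 3
    funext j
    rcases Fin.eq_zero_or_eq_succ j with rfl | ⟨j, rfl⟩
    · simp
    · simp

/-- Every tuple is the cone over its tail, so the cone formula gives the claim by induction. -/
theorem bd_bd {n : ℕ} (c : (Fin (n + 2) → K) →₀ ℤ) : bd n (bd (n + 1) c) = 0 := by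
  suffices (bd n).comp (bd (n + 1)) = (0 : ((Fin (n + 2) → K) →₀ ℤ) →ₗ[ℤ] _) from
    LinearMap.congr_fun this c
  clear c
  refine Finsupp.lhom_ext' fun x => LinearMap.ext_ring ?_
  simp only [LinearMap.comp_apply, Finsupp.lsingle_apply, LinearMap.zero_apply]
  induction n with
  | zero =>
    rw [← Fin.cons_self_tail x, ← cone_single, bd_cone_succ, map_sub, bd_cone_zero, sub_self]
  | succ n ih =>
    rw [← Fin.cons_self_tail x, ← cone_single, bd_cone_succ, map_sub, bd_cone_succ, ih, map_zero,
      sub_zero, sub_self]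

theorem map_bd (φ : K → K') {n : ℕ} (c : (Fin (n + 1) → K) →₀ ℤ) :
    map φ n (bd n c) = bd n (map φ (n + 1) c) := by
  suffices (map φ n).comp (bd n) = (bd n).comp (map φ (n + 1)) from LinearMap.congr_fun this c
  refine Finsupp.lhom_ext' fun x => LinearMap.ext_ring ?_
  simp only [LinearMap.comp_apply, Finsupp.lsingle_apply, map_single, bd_single, map_sum, map_smul]
  rfl

theorem map_cone (φ : K → K') (b : K) {n : ℕ} (c : (Fin n → K) →₀ ℤ) :
    map φ (n + 1) (cone b n c) = cone (φ b) n (map φ n c) := by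
  suffices (map φ (n + 1)).comp (cone b n) = (cone (φ b) n).comp (map φ n) from
    LinearMap.congr_fun this c
  refine Finsupp.lhom_ext' fun x => LinearMap.ext_ring ?_
  simp only [LinearMap.comp_apply, Finsupp.lsingle_apply, map_single, cone_single]
  rw [Fin.comp_cons]

/-- The evaluation of a function of tuples on chains. -/
def eval {n : ℕ} (ω : (Fin n → K) → ℤ) : ((Fin n → K) →₀ ℤ) →ₗ[ℤ] ℤ :=
  Finsupp.linearCombination ℤ ω

theorem eval_single {n : ℕ} (ω : (Fin n → K) → ℤ) (x : Fin n → K) :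
    eval ω (Finsupp.single x 1) = ω x := by
  simp [eval]

theorem eval_map {n : ℕ} (ω : (Fin n → K') → ℤ) (φ : K → K') (c : (Fin n → K) →₀ ℤ) :
    eval ω (map φ n c) = eval (fun t => ω (φ ∘ t)) c := by
  suffices (eval ω).comp (map φ n) = eval fun t => ω (φ ∘ t) from LinearMap.congr_fun this c
  refine Finsupp.lhom_ext' fun x => LinearMap.ext_ring ?_
  simp only [LinearMap.comp_apply, Finsupp.lsingle_apply, map_single, eval_single]

theorem eval_congr {n : ℕ} {ω ω' : (Fin n → K) → ℤ} {S : Set (Fin n → K)} (h : ∀ t ∈ S, ω t = ω' t)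
    {c : (Fin n → K) →₀ ℤ} (hc : c ∈ Finsupp.supported ℤ ℤ S) : eval ω c = eval ω' c := by
  rw [eval, eval, Finsupp.linearCombination_apply, Finsupp.linearCombination_apply]
  exact Finsupp.sum_congr fun t ht => by rw [h t ((Finsupp.mem_supported _ _).1 hc ht)]

theorem eval_zero {n : ℕ} (c : (Fin n → K) →₀ ℤ) : eval (fun _ => 0) c = 0 := by
  simp [eval, Finsupp.linearCombination_apply]

theorem mem_of_supported {α M : Type*} [AddCommGroup M] (f : (α →₀ ℤ) →ₗ[ℤ] M)
    {S : Set α} {N : Submodule ℤ M} (h : ∀ a ∈ S, f (Finsupp.single a 1) ∈ N) {c : α →₀ ℤ}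
    (hc : c ∈ Finsupp.supported ℤ ℤ S) : f c ∈ N := by
  rw [Finsupp.supported_eq_span_single] at hc
  have : Submodule.span ℤ ((fun i => Finsupp.single i (1 : ℤ)) '' S) ≤ N.comap f :=
    Submodule.span_le.2 (by rintro _ ⟨a, ha, rfl⟩; exact h a ha)
  exact this hc

end Algebra

/-! ### Barycentric subdivision -/

section Subdivision

variable {E E' : Type*} [AddCommGroup E] [Module ℝ E] [AddCommGroup E'] [Module ℝ E']

/-- The barycenter of a tuple of points. -/
def bary {n : ℕ} (x : Fin n → E) : E := (n : ℝ)⁻¹ • ∑ i, x i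

/-- The barycentric subdivision of chains of affine simplices. -/
def sd : ∀ n : ℕ, ((Fin n → E) →₀ ℤ) →ₗ[ℤ] ((Fin n → E) →₀ ℤ)
  | 0 => LinearMap.id
  | n + 1 => Finsupp.linearCombination ℤ fun x =>
      cone (bary x) n (sd n (bd n (Finsupp.single x 1)))

theorem sd_single {n : ℕ} (x : Fin (n + 1) → E) : sd (n + 1) (Finsupp.single x 1) =
    cone (bary x) n (sd n (bd n (Finsupp.single x 1))) := by
  simp [sd]

theorem bd_sd {n : ℕ} (c : (Fin (n + 1) → E) →₀ ℤ) : bd n (sd (n + 1) c) = sd n (bd n c) := by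
  suffices (bd n).comp (sd (n + 1)) = (sd n).comp (bd (K := E) n) from LinearMap.congr_fun this c
  induction n with
  | zero =>
    refine Finsupp.lhom_ext' fun x => LinearMap.ext_ring ?_
    simp only [LinearMap.comp_apply, Finsupp.lsingle_apply, sd_single, bd_cone_zero]
  | succ n ih =>
    refine Finsupp.lhom_ext' fun x => LinearMap.ext_ring ?_
    simp only [LinearMap.comp_apply, Finsupp.lsingle_apply, sd_single]
    have := LinearMap.congr_fun (ih (bd _ (Finsupp.single x 1))) (bd _ (Finsupp.single x 1))
    simp only [LinearMap.comp_apply] at this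
    rw [bd_cone_succ, this, bd_bd, map_zero, map_zero, sub_zero]

theorem map_sd (φ : E →ₗ[ℝ] E') {n : ℕ} (c : (Fin n → E) →₀ ℤ) :
    map φ n (sd n c) = sd n (map φ n c) := by
  suffices (map φ n).comp (sd n) = (sd n).comp (map φ n) from LinearMap.congr_fun this c
  induction n with
  | zero => rfl
  | succ n ih =>
    refine Finsupp.lhom_ext' fun x => LinearMap.ext_ring ?_
    simp only [LinearMap.comp_apply, Finsupp.lsingle_apply, sd_single, map_single]
    have := LinearMap.congr_fun (ih (bd _ (Finsupp.single x 1))) (bd _ (Finsupp.single x 1))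
    simp only [LinearMap.comp_apply] at this
    rw [map_cone, this, map_bd, map_single]
    congr 2
    simp [bary, map_sum]

theorem bd_iterate_sd (N : ℕ) {n : ℕ} (c : (Fin (n + 1) → E) →₀ ℤ) :
    bd n ((sd (n + 1))^[N] c) = (sd n)^[N] (bd n c) :=
  Function.Semiconj.iterate_right (f := bd n) (fun c => bd_sd c) N c

theorem map_iterate_sd (φ : E →ₗ[ℝ] E') (N : ℕ) {n : ℕ} (c : (Fin n → E) →₀ ℤ) :
    map φ n ((sd n)^[N] c) = (sd n)^[N] (map φ n c) :=
  Function.Semiconj.iterate_right (f := map φ n) (fun c => map_sd φ c) N c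

theorem iterate_sd_sum_smul (N : ℕ) {n : ℕ} {ι : Type*} (s : Finset ι) (a : ι → ℤ)
    (c : ι → (Fin n → E) →₀ ℤ) :
    (sd n)^[N] (∑ i ∈ s, a i • c i) = ∑ i ∈ s, a i • (sd n)^[N] (c i) := by
  rw [← Module.End.coe_pow, map_sum]
  simp only [map_smul]

end Subdivision

/-! ### The mesh of subdivisions -/

section Mesh

variable {E : Type*} [NormedAddCommGroup E] [NormedSpace ℝ E]

/-- The tuples of points in the convex hull of `x` with mutual distances at most `r`. -/
def smallTuples {n k : ℕ} (x : Fin k → E) (r : ℝ) : Set (Fin n → E) :=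
  {t | (∀ i, t i ∈ convexHull ℝ (Set.range x)) ∧ ∀ i j, dist (t i) (t j) ≤ r}

theorem bary_mem {n : ℕ} (x : Fin (n + 1) → E) : bary x ∈ convexHull ℝ (Set.range x) := by
  rw [bary, Finset.smul_sum]
  refine (convex_convexHull ℝ _).sum_mem (fun _ _ => by positivity) ?_
    fun i _ => subset_convexHull ℝ _ ⟨i, rfl⟩
  rw [Finset.sum_const, Finset.card_univ, Fintype.card_fin, nsmul_eq_mul]
  exact mul_inv_cancel₀ (by positivity)

/-- The difference is the average of n + 1 vectors x i - x j, one of which vanishes. -/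
theorem dist_bary_le {n : ℕ} {x : Fin (n + 1) → E} {r : ℝ} (hx : ∀ i j, dist (x i) (x j) ≤ r)
    (i : Fin (n + 1)) : dist (x i) (bary x) ≤ n / (n + 1) * r := by
  have hn : (0 : ℝ) < n + 1 := by positivity
  have e : x i - bary x = ((n : ℝ) + 1)⁻¹ • ∑ j ∈ Finset.univ.erase i, (x i - x j) := by
    have : ∑ j ∈ Finset.univ.erase i, (x i - x j) = ∑ j, (x i - x j) := by
      rw [← Finset.add_sum_erase _ _ (Finset.mem_univ i), sub_self, zero_add]
    rw [this, Finset.sum_sub_distrib, Finset.sum_const, Finset.card_univ, Fintype.card_fin, bary,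
      smul_sub, ← Nat.cast_smul_eq_nsmul ℝ, smul_smul]
    push_cast
    rw [inv_mul_cancel₀ hn.ne', one_smul]
  rw [dist_eq_norm, e, norm_smul, norm_inv, Real.norm_of_nonneg hn.le]
  have h1 : ‖∑ j ∈ Finset.univ.erase i, (x i - x j)‖ ≤ n * r := by
    refine (norm_sum_le _ _).trans ((Finset.sum_le_sum (g := fun _ => r) fun j _ => ?_).trans ?_)
    · rw [← dist_eq_norm]
      exact hx i j
    · simp [Finset.card_erase_of_mem]
  calc ((n : ℝ) + 1)⁻¹ * _ ≤ ((n : ℝ) + 1)⁻¹ * (n * r) := by gcongr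
    _ = n / (n + 1) * r := by ring

/-- Subdivided simplices are cones from the barycenter over subdivided faces. Edges at the apex are
bounded by `dist_bary_le`, the others by induction, as the factor (n - 1) / n increases with n. -/
theorem sd_mem_smallTuples {n : ℕ} {x : Fin n → E} {r : ℝ} (hr : 0 ≤ r)
    (hx : ∀ i j, dist (x i) (x j) ≤ r) :
    sd n (Finsupp.single x 1) ∈ Finsupp.supported ℤ ℤ (smallTuples x (((n : ℝ) - 1) / n * r)) := by
  induction n with
  | zero => exact Finsupp.single_mem_supported ℤ 1 ⟨fun i => i.elim0, fun i => i.elim0⟩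
  | succ n ih =>
    rw [sd_single]
    have hsd : sd n (bd n (Finsupp.single x 1)) ∈
        Finsupp.supported ℤ ℤ (smallTuples x (((n : ℝ) - 1) / n * r)) := by
      rw [bd_single, map_sum]
      refine Submodule.sum_mem _ fun i _ => ?_
      rw [map_smul]
      refine Submodule.smul_mem _ _ (Finsupp.supported_mono ?_
        (ih (x := x ∘ i.succAbove) fun _ _ => hx _ _))
      exact fun t ht => ⟨fun j => convexHull_mono (Set.range_comp_subset_range _ _) (ht.1 j), ht.2⟩
    refine mem_of_supported _ (fun t ht => ?_) hsd
    rw [cone_single]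
    refine Finsupp.single_mem_supported ℤ 1 ?_
    have hκ : ((n + 1 : ℕ) : ℝ) - 1 = n := by push_cast; ring
    rw [hκ]
    have hb (j : Fin n) : dist (t j) (bary x) ≤ n / (n + 1 : ℕ) * r := by
      have : convexHull ℝ (Set.range x) ⊆ Metric.closedBall (bary x) (n / (n + 1 : ℕ) * r) := by
        refine convexHull_min ?_ (convex_closedBall _ _)
        rintro _ ⟨i, rfl⟩
        push_cast
        exact dist_bary_le hx i
      exact this (ht.1 j)
    have hmono : ((n : ℝ) - 1) / n * r ≤ n / (n + 1 : ℕ) * r := by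
      refine mul_le_mul_of_nonneg_right ?_ hr
      rcases Nat.eq_zero_or_pos n with rfl | hn
      · simp
      · have : (0 : ℝ) < n := by exact_mod_cast hn
        rw [div_le_div_iff₀ this (by positivity)]
        push_cast
        nlinarith
    have h0 : (0 : ℝ) ≤ n / (n + 1 : ℕ) * r := by positivity
    constructor
    · intro i
      rcases Fin.eq_zero_or_eq_succ i with rfl | ⟨i, rfl⟩
      · exact bary_mem x
      · exact ht.1 i
    · intro i j
      rcases Fin.eq_zero_or_eq_succ i with rfl | ⟨i, rfl⟩ <;>
      rcases Fin.eq_zero_or_eq_succ j with rfl | ⟨j, rfl⟩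
      · simpa using h0
      · rw [dist_comm]
        exact hb j
      · exact hb i
      · exact (ht.2 i j).trans hmono

theorem iterate_sd_mem_smallTuples {n : ℕ} {x : Fin n → E} {r : ℝ} (hr : 0 ≤ r)
    (hx : ∀ i j, dist (x i) (x j) ≤ r) (N : ℕ) :
    (sd n)^[N] (Finsupp.single x 1) ∈
      Finsupp.supported ℤ ℤ (smallTuples x ((((n : ℝ) - 1) / n) ^ N * r)) := by
  rcases Nat.eq_zero_or_pos n with rfl | hn
  · exact fun t _ => ⟨fun i => i.elim0, fun i => i.elim0⟩
  have hκ : 0 ≤ ((n : ℝ) - 1) / n :=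
    div_nonneg (sub_nonneg.2 (by exact_mod_cast hn)) (Nat.cast_nonneg n)
  induction N with
  | zero =>
    refine Finsupp.single_mem_supported ℤ 1 ⟨fun i => subset_convexHull ℝ _ ⟨i, rfl⟩, ?_⟩
    simpa using hx
  | succ N ih =>
    rw [Function.iterate_succ_apply']
    refine mem_of_supported _ (fun t ht => ?_) ih
    refine Finsupp.supported_mono ?_ (sd_mem_smallTuples (by positivity) ht.2)
    intro t' ht'
    refine ⟨fun i => convexHull_min ?_ (convex_convexHull ℝ _) (ht'.1 i), fun i j => ?_⟩
    · rintro _ ⟨j, rfl⟩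
      exact ht.1 j
    · rw [pow_succ', mul_assoc]
      exact ht'.2 i j

end Mesh

/-! ### Sperner's lemma through determinants -/

section Coloring

/-- The signed indicator of the tuples in which each of the colors `0, …, n - 1` occurs. -/
def rainbow (n : ℕ) (a : Fin n → ℕ) : ℤ :=
  (Matrix.of fun i j : Fin n => if a j = i then (1 : ℤ) else 0).det

/-- The signed indicator of the tuples in which each of the colors `1, …, n` occurs. -/
def rainbowSucc (n : ℕ) (a : Fin n → ℕ) : ℤ :=
  (Matrix.of fun i j : Fin n => if a j = i + 1 then (1 : ℤ) else 0).det

theorem rainbow_eq_zero {n : ℕ} {a : Fin n → ℕ} (i : Fin n) (h : ∀ j, a j ≠ i) :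
    rainbow n a = 0 :=
  Matrix.det_eq_zero_of_row_eq_zero i fun j => by simp [h j]

theorem rainbowSucc_eq_zero {n : ℕ} {a : Fin n → ℕ} (i : Fin n) (h : ∀ j, a j ≠ i + 1) :
    rainbowSucc n a = 0 :=
  Matrix.det_eq_zero_of_row_eq_zero i fun j => by simp [h j]

/-- Every column of the matrix contains exactly one 1. Adding all other rows to the first turns it
into a row of ones without changing the determinant, and expansion along that row gives the minors.
-/
theorem rainbow_eq_sum {n : ℕ} {a : Fin (n + 1) → ℕ} (ha : ∀ j, a j < n + 1) :
    rainbow (n + 1) a =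
      ∑ j : Fin (n + 1), (-1 : ℤ) ^ (j : ℕ) * rainbowSucc n (a ∘ j.succAbove) := by
  set M : Matrix (Fin (n + 1)) (Fin (n + 1)) ℤ := Matrix.of fun i j => if a j = i then 1 else 0
  have h1 : (M.updateRow 0 (∑ k, (1 : ℤ) • M k)).det = (1 : ℤ) • M.det :=
    Matrix.det_updateRow_sum M 0 fun _ => 1
  rw [one_smul] at h1
  rw [rainbow, ← h1, Matrix.det_succ_row_zero]
  refine Finset.sum_congr rfl fun j _ => ?_
  have h2 : M.updateRow 0 (∑ k, (1 : ℤ) • M k) 0 j = 1 := by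
    rw [Matrix.updateRow_self, Finset.sum_apply]
    rw [Finset.sum_eq_single (⟨a j, ha j⟩ : Fin (n + 1))]
    · simp [M]
    · intro k _ hk
      have : a j ≠ k := fun e => hk (Fin.ext e.symm)
      simp [M, this]
    · simp
  rw [h2, mul_one, rainbowSucc]
  congr 2

/-- A discrete Stokes theorem: as long as no further colors occur, `rainbow` is the coboundary of
`rainbowSucc`. -/
theorem eval_rainbow {K : Type*} {n : ℕ} (g : K → ℕ) {c : (Fin (n + 1) → K) →₀ ℤ}
    (hc : c ∈ Finsupp.supported ℤ ℤ {t | ∀ j, g (t j) < n + 1}) :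
    eval (fun t => rainbow (n + 1) (g ∘ t)) c = eval (fun t => rainbowSucc n (g ∘ t)) (bd n c) := by
  have key : eval (fun t => rainbow (n + 1) (g ∘ t)) c -
      eval (fun t => rainbowSucc n (g ∘ t)) (bd n c) ∈ (⊥ : Submodule ℤ ℤ) := by
    refine mem_of_supported (eval (fun t => rainbow (n + 1) (g ∘ t)) -
      (eval fun t => rainbowSucc n (g ∘ t)).comp (bd n)) (fun t ht => ?_) hc
    simp only [LinearMap.sub_apply, LinearMap.comp_apply, eval_single, bd_single, map_sum, map_smul]
    rw [rainbow_eq_sum (a := g ∘ t) ht, Submodule.mem_bot, sub_eq_zero]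
    rfl
  rwa [Submodule.mem_bot, sub_eq_zero] at key

/-- The tuple of the vertices of the standard simplex. -/
def stdTuple (n : ℕ) : Fin n → Fin n → ℝ := fun i => Pi.single i 1

theorem dist_stdTuple_le (n : ℕ) (i j : Fin n) : dist (stdTuple n i) (stdTuple n j) ≤ 1 := by
  refine (dist_pi_le_iff zero_le_one).2 fun k => ?_
  simp only [stdTuple, Pi.single_apply, Real.dist_eq]
  split_ifs <;> norm_num

theorem convexHull_stdTuple (n : ℕ) :
    convexHull ℝ (Set.range (stdTuple n)) = stdSimplex ℝ (Fin n) :=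
  convexHull_rangle_single_eq_stdSimplex (R := ℝ) (ι := Fin n)

theorem iterate_sd_stdTuple_mem (n N : ℕ) : (sd n)^[N] (Finsupp.single (stdTuple n) 1) ∈
    Finsupp.supported ℤ ℤ {t | ∀ j, t j ∈ stdSimplex ℝ (Fin n)} := by
  refine Finsupp.supported_mono (fun t ht j => ?_)
    (iterate_sd_mem_smallTuples zero_le_one (dist_stdTuple_le n) N)
  rw [← convexHull_stdTuple]
  exact ht.1 j

/-- The linear map that inserts the coordinate `0` at the position `k`. -/
def faceMap {n : ℕ} (k : Fin (n + 1)) : (Fin n → ℝ) →ₗ[ℝ] (Fin (n + 1) → ℝ) :=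
  FunOnFinite.linearMap ℝ ℝ k.succAbove

theorem faceMap_comp_stdTuple {n : ℕ} (k : Fin (n + 1)) :
    faceMap k ∘ stdTuple n = stdTuple (n + 1) ∘ k.succAbove := by
  funext i
  simp [faceMap, stdTuple]

theorem faceMap_apply_self {n : ℕ} (k : Fin (n + 1)) (x : Fin n → ℝ) : faceMap k x k = 0 := by
  rw [faceMap, FunOnFinite.linearMap_apply_apply]
  exact Finset.sum_eq_zero fun i hi => absurd (Finset.mem_filter.1 hi).2 (Fin.succAbove_ne k i)

theorem faceMap_apply_succAbove {n : ℕ} (k : Fin (n + 1)) (x : Fin n → ℝ) (i : Fin n) :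
    faceMap k x (k.succAbove i) = x i := by
  rw [faceMap, FunOnFinite.linearMap_apply_apply, Finset.sum_eq_single i]
  · intro j hj hne
    exact absurd (Fin.succAbove_right_injective (Finset.mem_filter.1 hj).2) hne
  · simp

theorem faceMap_mem {n : ℕ} (k : Fin (n + 1)) {x : Fin n → ℝ} (hx : x ∈ stdSimplex ℝ (Fin n)) :
    faceMap k x ∈ stdSimplex ℝ (Fin (n + 1)) := by
  constructor
  · intro i
    rcases eq_or_ne i k with rfl | hne
    · rw [faceMap_apply_self]
    · obtain ⟨j, rfl⟩ := Fin.exists_succAbove_eq hne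
      rw [faceMap_apply_succAbove]
      exact hx.1 j
  · rw [Fin.sum_univ_succAbove _ k, faceMap_apply_self, zero_add]
    simp only [faceMap_apply_succAbove]
    exact hx.2

theorem bd_iterate_sd_stdTuple (n N : ℕ) :
    bd n ((sd (n + 1))^[N] (Finsupp.single (stdTuple (n + 1)) 1)) =
      ∑ k : Fin (n + 1), (-1 : ℤ) ^ (k : ℕ) •
        map (faceMap k) n ((sd n)^[N] (Finsupp.single (stdTuple n) 1)) := by
  rw [bd_iterate_sd, bd_single, iterate_sd_sum_smul]
  refine Finset.sum_congr rfl fun k _ => ?_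
  rw [map_iterate_sd, map_single, faceMap_comp_stdTuple]

theorem eval_rainbowSucc_face_zero {n : ℕ} {g : (Fin n → ℝ) → ℕ}
    (hg : ∀ x ∈ stdSimplex ℝ (Fin n), ∃ l : Fin (n + 1), g x = l ∧ 0 < faceMap 0 x l) (N : ℕ) :
    (∀ x ∈ stdSimplex ℝ (Fin n), ∃ i : Fin n, g x - 1 = i ∧ 0 < x i) ∧
    eval (fun t => rainbowSucc n (g ∘ t)) ((sd n)^[N] (Finsupp.single (stdTuple n) 1)) =
      eval (fun t => rainbow n ((fun x => g x - 1) ∘ t))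
        ((sd n)^[N] (Finsupp.single (stdTuple n) 1)) := by
  have key : ∀ x ∈ stdSimplex ℝ (Fin n), ∃ i : Fin n, g x = i + 1 ∧ 0 < x i := by
    intro x hx
    obtain ⟨l, hl, hpos⟩ := hg x hx
    have hl0 : l ≠ 0 := by
      rintro rfl
      rw [faceMap_apply_self] at hpos
      exact lt_irrefl _ hpos
    obtain ⟨l, rfl⟩ := Fin.exists_succ_eq.2 hl0
    refine ⟨l, by simp [hl], ?_⟩
    rwa [← Fin.zero_succAbove, faceMap_apply_succAbove] at hpos
  refine ⟨fun x hx => ?_, eval_congr (fun t ht => ?_) (iterate_sd_stdTuple_mem n N)⟩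
  · obtain ⟨i, hi, hpos⟩ := key x hx
    exact ⟨i, by simp [hi], hpos⟩
  · rw [rainbow, rainbowSucc]
    congr 1
    ext i j
    obtain ⟨l, hl, -⟩ := key _ (ht j)
    simp [hl]

/-- The face opposite to vertex k + 1 misses color k + 1, which `rainbowSucc` requires. -/
theorem eval_rainbowSucc_face_succ {n : ℕ} {g : (Fin n → ℝ) → ℕ} (k : Fin n)
    (hg : ∀ x ∈ stdSimplex ℝ (Fin n), ∃ l : Fin (n + 1), g x = l ∧ 0 < faceMap k.succ x l) (N : ℕ) :
    eval (fun t => rainbowSucc n (g ∘ t)) ((sd n)^[N] (Finsupp.single (stdTuple n) 1)) = 0 := by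
  rw [eval_congr (ω' := fun _ => 0) (fun t ht => ?_) (iterate_sd_stdTuple_mem n N), eval_zero]
  refine rainbowSucc_eq_zero k fun j e => ?_
  obtain ⟨l, hl, hpos⟩ := hg _ (ht j)
  have : l = k.succ := Fin.ext (by rw [← hl, Fin.val_succ]; exact e)
  rw [this, faceMap_apply_self] at hpos
  exact lt_irrefl _ hpos

/-- Sperner's lemma for iterated barycentric subdivisions. -/
theorem eval_rainbow_iterate_sd {n : ℕ} {g : (Fin n → ℝ) → ℕ}
    (hg : ∀ x ∈ stdSimplex ℝ (Fin n), ∃ i : Fin n, g x = i ∧ 0 < x i) (N : ℕ) :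
    eval (fun t => rainbow n (g ∘ t)) ((sd n)^[N] (Finsupp.single (stdTuple n) 1)) = 1 := by
  induction n with
  | zero =>
    rw [show (sd 0 : ((Fin 0 → Fin 0 → ℝ) →₀ ℤ) →ₗ[ℤ] _) = LinearMap.id from rfl]
    simp [eval_single, rainbow]
  | succ n ih =>
    have hsub : {t : Fin (n + 1) → Fin (n + 1) → ℝ | ∀ j, t j ∈ stdSimplex ℝ (Fin (n + 1))} ⊆
        {t | ∀ j, g (t j) < n + 1} := fun t ht j => by
      obtain ⟨i, hi, -⟩ := hg _ (ht j)
      rw [hi]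
      exact i.2
    -- The count moves to the boundary, where only the face opposite to vertex 0 contributes.
    rw [eval_rainbow g (Finsupp.supported_mono hsub (iterate_sd_stdTuple_mem _ N)),
      bd_iterate_sd_stdTuple, map_sum, Fin.sum_univ_succ, Finset.sum_eq_zero, add_zero]
    · simp only [Fin.val_zero, pow_zero, one_smul]
      rw [eval_map]
      obtain ⟨h1, h2⟩ := eval_rainbowSucc_face_zero (g := fun x => g (faceMap 0 x))
        (fun x hx => hg _ (faceMap_mem 0 hx)) N
      exact h2.trans (ih h1)
    · intro k _
      rw [map_smul, eval_map]
      exact smul_eq_zero_of_right _ (eval_rainbowSucc_face_succ (g := fun x => g (faceMap k.succ x))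
        k (fun x hx => hg _ (faceMap_mem k.succ hx)) N)

end Coloring

end TupleChain

/-! ### Singular simplices and the counting cochain -/

section SingularSimplices

open Opposite Simplicial

/-- The singular simplex given by a continuous map from the standard simplex. -/
def singularSimplex (X : TopCat.{u}) {n : ℕ} (σ : C(stdSimplex ℝ (Fin (n + 1)), X)) :
    (TopCat.toSSet.obj X) _⦋n⦌ :=
  (X.toSSetObjEquiv (op ⦋n⦌)).symm σ

/-- The inclusion of a face of the standard simplex. -/
def stdFace {n : ℕ} (k : Fin (n + 2)) :
    C(stdSimplex ℝ (Fin (n + 1)), stdSimplex ℝ (Fin (n + 2))) :=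
  ⟨stdSimplex.map k.succAbove, stdSimplex.continuous_map _⟩

theorem toSSetObjEquiv_δ (X : TopCat.{u}) {n : ℕ} (k : Fin (n + 2))
    (x : (TopCat.toSSet.obj X) _⦋n + 1⦌) :
    X.toSSetObjEquiv (op ⦋n⦌) ((TopCat.toSSet.obj X).δ k x) =
      (X.toSSetObjEquiv (op ⦋n + 1⦌) x).comp (stdFace k) := rfl

theorem δ_singularSimplex (X : TopCat.{u}) {n : ℕ} (k : Fin (n + 2))
    (σ : C(stdSimplex ℝ (Fin (n + 2)), X)) :
    (TopCat.toSSet.obj X).δ k (singularSimplex X σ) = singularSimplex X (σ.comp (stdFace k)) := rfl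

theorem map_singularSimplex {X Y : TopCat.{u}} (f : X ⟶ Y) {n : ℕ}
    (σ : C(stdSimplex ℝ (Fin (n + 1)), X)) :
    (TopCat.toSSet.map f).app _ (singularSimplex X σ) = singularSimplex Y (f.hom.comp σ) := rfl

end SingularSimplices

section RainbowCount

open TupleChain

variable {X : Type*} [TopologicalSpace X]

/-- A coloring of `X` pulled back along a singular simplex. -/
def pullColor (col : X → ℕ) {n : ℕ} (σ : C(stdSimplex ℝ (Fin n), X)) (x : Fin n → ℝ) : ℕ :=
  open Classical in if hx : x ∈ stdSimplex ℝ (Fin n) then col (σ ⟨x, hx⟩) else 0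

theorem pullColor_of_mem (col : X → ℕ) {n : ℕ} (σ : C(stdSimplex ℝ (Fin n), X)) {x : Fin n → ℝ}
    (hx : x ∈ stdSimplex ℝ (Fin n)) : pullColor col σ x = col (σ ⟨x, hx⟩) := dif_pos hx

/-- The number of simplices with the colors `1, …, n`, counted with signs, in an iterated
subdivision of a singular simplex. -/
def rainbowCount (col : X → ℕ) {n : ℕ} (σ : C(stdSimplex ℝ (Fin n), X)) (N : ℕ) : ℤ :=
  eval (fun t => rainbowSucc n (pullColor col σ ∘ t)) ((sd n)^[N] (Finsupp.single (stdTuple n) 1))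

/-- Stokes on the subdivided simplex: the coboundary of `rainbowCount` counts the small simplices
with all n + 2 colors. -/
theorem sum_rainbowCount_face {col : X → ℕ} {n : ℕ} (hcol : ∀ x, col x < n + 2)
    (τ : C(stdSimplex ℝ (Fin (n + 2)), X)) (N : ℕ) :
    ∑ k : Fin (n + 2), (-1 : ℤ) ^ (k : ℕ) • rainbowCount col (τ.comp (stdFace k)) N =
      eval (fun t => rainbow (n + 2) (pullColor col τ ∘ t))
        ((sd (n + 2))^[N] (Finsupp.single (stdTuple (n + 2)) 1)) := by
  have hsub : {t : Fin (n + 2) → Fin (n + 2) → ℝ | ∀ j, t j ∈ stdSimplex ℝ (Fin (n + 2))} ⊆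
      {t | ∀ j, pullColor col τ (t j) < n + 2} := fun t ht j => by
    rw [pullColor_of_mem _ _ (ht j)]
    exact hcol _
  rw [eval_rainbow _ (Finsupp.supported_mono hsub (iterate_sd_stdTuple_mem _ N)),
    bd_iterate_sd_stdTuple, map_sum]
  refine Finset.sum_congr rfl fun k _ => ?_
  rw [map_smul, TupleChain.eval_map, rainbowCount]
  congr 1
  refine eval_congr (fun t ht => ?_) (iterate_sd_stdTuple_mem _ N)
  congr 1
  funext j
  simp only [Function.comp_apply]
  rw [pullColor_of_mem _ _ (ht j), pullColor_of_mem _ _ (faceMap_mem k (ht j))]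
  rfl

/-- The complements of the `C i` pull back to an open cover. Once the mesh is below its Lebesgue
number, each small simplex avoids some `C i` and therefore lacks color i. -/
theorem eventually_eval_rainbow_eq_zero {col : X → ℕ} {n : ℕ} {C : Fin (n + 1) → Set X}
    (hC : ∀ i, IsClosed (C i)) (hcol : ∀ x (i : Fin (n + 1)), col x = i → x ∈ C i) (hempty : ⋂ i, C i = ∅)
    (τ : C(stdSimplex ℝ (Fin (n + 1)), X)) :
    ∀ᶠ N in Filter.atTop, eval (fun t => rainbow (n + 1) (pullColor col τ ∘ t))
        ((sd (n + 1))^[N] (Finsupp.single (stdTuple (n + 1)) 1)) = 0 := by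
  obtain ⟨δ, hδ, hball⟩ := lebesgue_number_lemma_of_metric
    (isCompact_univ (X := stdSimplex ℝ (Fin (n + 1)))) (c := fun i => (τ ⁻¹' C i)ᶜ)
    (fun i => ((hC i).preimage τ.continuous).isOpen_compl) (by
      rw [← Set.compl_iInter, ← Set.preimage_iInter, hempty]
      simp)
  have hκ : (((n + 1 : ℕ) : ℝ) - 1) / (n + 1 : ℕ) < 1 := by
    rw [div_lt_one (by positivity)]
    linarith
  have hκ0 : 0 ≤ (((n + 1 : ℕ) : ℝ) - 1) / (n + 1 : ℕ) :=
    div_nonneg (by push_cast; linarith [Nat.cast_nonneg (α := ℝ) n]) (Nat.cast_nonneg _)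
  have hlim : Filter.Tendsto (fun N : ℕ => ((((n + 1 : ℕ) : ℝ) - 1) / (n + 1 : ℕ)) ^ N * 1) Filter.atTop (𝓝 0) := by
    simpa using tendsto_pow_atTop_nhds_zero_of_lt_one hκ0 hκ
  filter_upwards [hlim.eventually (gt_mem_nhds hδ)] with N hN
  rw [eval_congr (ω' := fun _ => 0) (fun t ht => ?_)
    (iterate_sd_mem_smallTuples zero_le_one (dist_stdTuple_le (n + 1)) N), eval_zero]
  have hmem (j) : t j ∈ stdSimplex ℝ (Fin (n + 1)) := by
    rw [← convexHull_stdTuple]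
    exact ht.1 j
  obtain ⟨i, hi⟩ := hball ⟨t 0, hmem _⟩ (Set.mem_univ _)
  refine rainbow_eq_zero i fun j e => ?_
  simp only [Function.comp_apply] at e
  rw [pullColor_of_mem _ _ (hmem j)] at e
  exact hi (Metric.mem_ball.2 ((ht.2 j 0).trans_lt hN)) (hcol _ _ e)

end RainbowCount

/-! ### Detecting a nonzero map in reduced homology -/

section NontrivialClass

open AlgebraicTopology

/-- The coefficient group of `integralHomology`. -/
abbrev intCoeff : ModuleCat.{u} ℤ := ModuleCat.of ℤ (ULift.{u} ℤ)

/-- The homomorphism from the integers that takes the value `a` at `1`. -/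
def homOfValue (A : Type) [AddCommGroup A] :
    A →+ (intCoeff.{u} ⟶ ModuleCat.of ℤ (ULift.{u} A)) where
  toFun a := ModuleCat.ofHom
    ((LinearMap.toSpanSingleton ℤ (ULift.{u} A) ⟨a⟩).comp ULift.moduleEquiv.toLinearMap)
  map_zero' := by
    ext
    simp
  map_add' a b := by
    ext
    simp

theorem homOfValue_injective (A : Type) [AddCommGroup A] :
    Function.Injective (homOfValue.{u} A) := fun a b h => by
  have := congrArg (fun f : intCoeff.{u} ⟶ ModuleCat.of ℤ (ULift.{u} A) =>
    ULift.down (f.hom (ULift.up 1))) h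
  simpa [homOfValue] using this

/-- The singular chains with integer coefficients. -/
abbrev intChains (X : TopCat.{u}) : ChainComplex (ModuleCat.{u} ℤ) ℕ :=
  (TopCat.toSSet.obj X).chainComplex intCoeff.{u}

/-- The map induced on singular chains. -/
abbrev intChainsMap {X Y : TopCat.{u}} (f : X ⟶ Y) : intChains X ⟶ intChains Y :=
  SSet.chainComplexMap (TopCat.toSSet.map f) intCoeff.{u}

theorem mono_intChainsMap_f {X Y : TopCat.{u}} (f : X ⟶ Y) [Mono f] (n : ℕ) :
    Mono ((((singularChainComplexFunctor (ModuleCat.{u} ℤ)).obj intCoeff.{u}).map f).f n) :=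
  inferInstance

theorem comp_eq_zero_of_kernelMap_eq_zero {R M N P : ModuleCat.{u} ℤ} (a : M ⟶ P) (b : N ⟶ P)
    (f : M ⟶ N) (comm : a ≫ 𝟙 P = f ≫ b) (h : kernel.map a b f (𝟙 P) comm = 0) (c : R ⟶ M)
    (hc : c ≫ a = 0) : c ≫ f = 0 := by
  have h1 : kernel.lift a c hc ≫ kernel.map a b f (𝟙 P) comm ≫ kernel.ι b = c ≫ f := by simp
  rw [← h1, h, zero_comp, comp_zero]

/-- The class of z dies in W, and the map from X to a point factors through W, so the class is
reduced. The cocycle φ descends to the homology of Y and detects its image. -/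
theorem reducedHomologyMap_ne_zero_of_pairing (q : ℕ) {X Y W : TopCat.{u}} (i : X ⟶ Y) (j : X ⟶ W)
    {A : ModuleCat.{u} ℤ} (z : intCoeff ⟶ (intChains X).X q) (hz : ∀ k, z ≫ (intChains X).d q k = 0)
    (w : intCoeff ⟶ (intChains W).X (q + 1))
    (hw : z ≫ (intChainsMap j).f q = w ≫ (intChains W).d (q + 1) q)
    (φ : (intChains Y).X q ⟶ A) (hφ : (intChains Y).d (q + 1) q ≫ φ = 0)
    (hne : z ≫ (intChainsMap i).f q ≫ φ ≠ 0) : reducedHomologyMap q i ≠ 0 := by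
  intro h0
  let c : intCoeff ⟶ (intChains X).homology q :=
    (intChains X).liftCycles z _ rfl (hz _) ≫ (intChains X).homologyπ q
  let c₁ : intCoeff ⟶ (integralHomology q).obj X := c
  have hcW : c₁ ≫ (integralHomology q).map j = 0 := by
    change c ≫ HomologicalComplex.homologyMap (intChainsMap j) q = 0
    simp only [c, Category.assoc, HomologicalComplex.homologyπ_naturality,
      HomologicalComplex.liftCycles_comp_cyclesMap_assoc]
    exact (intChains W).liftCycles_homologyπ_eq_zero_of_boundary _ _ rfl w hw
  have hcpt : c₁ ≫ (integralHomology q).map (toPoint X) = 0 := by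
    have e : toPoint X = j ≫ toPoint W := rfl
    rw [e, Functor.map_comp, ← Category.assoc, hcW, zero_comp]
  have h2 : c ≫ HomologicalComplex.homologyMap (intChainsMap i) q = 0 :=
    comp_eq_zero_of_kernelMap_eq_zero _ _ _ (by rw [Category.comp_id, ← Functor.map_comp]; rfl)
      h0 c₁ hcpt
  apply hne
  have h3 : z ≫ (intChainsMap i).f q ≫ φ =
      (c ≫ HomologicalComplex.homologyMap (intChainsMap i) q) ≫ (intChains Y).homologyι q ≫
        (intChains Y).descOpcycles φ (q + 1) (by simp) hφ := by
    simp only [c, Category.assoc, HomologicalComplex.homologyπ_naturality_assoc,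
      HomologicalComplex.liftCycles_comp_cyclesMap_assoc, HomologicalComplex.homology_π_ι_assoc,
      HomologicalComplex.p_descOpcycles, HomologicalComplex.liftCycles_i_assoc]
  rw [h3, h2, zero_comp]

/-- The boundary of F is a cycle in X. The empty intersection of the `C k` makes the color count a
cocycle on Y, and the Sperner condition on the faces gives it the value 1 on that cycle. -/
theorem reducedHomologyMap_ne_zero_of_coloring {q : ℕ} {X Y W : TopCat.{u}} (i : X ⟶ Y) (j : X ⟶ W)
    [Mono j] (F : C(stdSimplex ℝ (Fin (q + 2)), W))
    (f : Fin (q + 2) → C(stdSimplex ℝ (Fin (q + 1)), X))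
    (hf : ∀ k, j.hom.comp (f k) = F.comp (stdFace k)) (col : Y → ℕ) (hcol : ∀ y, col y < q + 2)
    {C : Fin (q + 2) → Set Y} (hC : ∀ k, IsClosed (C k))
    (hcolC : ∀ y (k : Fin (q + 2)), col y = k → y ∈ C k) (hempty : ⋂ k, C k = ∅)
    (hS : ∀ k t, ∃ l : Fin (q + 2), col (i (f k t)) = l ∧ 0 < stdFace k t l) :
    reducedHomologyMap q i ≠ 0 := by
  let w : intCoeff ⟶ (intChains W).X (q + 1) :=
    (TopCat.toSSet.obj W).ιChainComplex (singularSimplex W F)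
  let z : intCoeff ⟶ (intChains X).X q := ∑ k : Fin (q + 2), (-1) ^ (k : ℕ) •
    (TopCat.toSSet.obj X).ιChainComplex (singularSimplex X (f k))
  have hw : z ≫ (intChainsMap j).f q = w ≫ (intChains W).d (q + 1) q := by
    simp only [z, w, SSet.ιChainComplex_d, Preadditive.sum_comp, Preadditive.zsmul_comp,
      SSet.ι_chainComplexMap_f, map_singularSimplex, hf, δ_singularSimplex]
  -- Chains of X inject into chains of W, where z is a boundary.
  have hz (k : ℕ) : z ≫ (intChains X).d q k = 0 := by
    have : Mono ((intChainsMap j).f k) := mono_intChainsMap_f j k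
    rw [← cancel_mono ((intChainsMap j).f k), Category.assoc, zero_comp,
      ← (intChainsMap j).comm, ← Category.assoc, hw, Category.assoc, HomologicalComplex.d_comp_d,
      comp_zero]
  -- How often one must subdivide depends on the singular simplex, so a fixed N need not give a
  -- cocycle. The germ of the counts at infinity does.
  let A := Filter.Germ (Filter.atTop : Filter ℕ) ℤ
  let cnt (σ : C(stdSimplex ℝ (Fin (q + 1)), Y)) : A :=
    ((fun N => rainbowCount col σ N : ℕ → ℤ) : A)
  let φ : (intChains Y).X q ⟶ ModuleCat.of ℤ (ULift.{u} A) :=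
    ((TopCat.toSSet.obj Y).isColimitChainComplexXCofan intCoeff q).desc
      (Cofan.mk _ fun x => homOfValue A (cnt (Y.toSSetObjEquiv _ x)))
  have hφι (x) : (TopCat.toSSet.obj Y).ιChainComplex x ≫ φ =
      homOfValue A (cnt (Y.toSSetObjEquiv _ x)) :=
    ((TopCat.toSSet.obj Y).isColimitChainComplexXCofan intCoeff q).fac _ ⟨x⟩
  have hgerm (a : Fin (q + 2) → ℕ → ℤ) :
      ∑ k : Fin (q + 2), (-1 : ℤ) ^ (k : ℕ) • ((a k : ℕ → ℤ) : A) =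
        ((fun N => ∑ k : Fin (q + 2), (-1 : ℤ) ^ (k : ℕ) • a k N : ℕ → ℤ) : A) := by
    have e : (fun N => ∑ k : Fin (q + 2), (-1 : ℤ) ^ (k : ℕ) • a k N) =
        ∑ k : Fin (q + 2), (-1 : ℤ) ^ (k : ℕ) • a k := by
      funext N
      simp
    rw [e]
    exact (map_sum (Filter.Germ.coeAddHom (Filter.atTop : Filter ℕ) (M := ℤ))
      (fun k : Fin (q + 2) => (-1 : ℤ) ^ (k : ℕ) • a k) Finset.univ).symm
  have hφ : (intChains Y).d (q + 1) q ≫ φ = 0 := by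
    refine SSet.chainComplex_hom_ext fun x => ?_
    rw [SSet.ιChainComplex_d_assoc, Preadditive.sum_comp, comp_zero]
    simp only [Preadditive.zsmul_comp, hφι, toSSetObjEquiv_δ]
    rw [← map_zero (homOfValue A)]
    simp only [← map_zsmul, ← map_sum]
    congr 1
    rw [hgerm]
    refine Filter.Germ.coe_eq.2 ?_
    filter_upwards [eventually_eval_rainbow_eq_zero hC hcolC hempty (Y.toSSetObjEquiv _ x)] with N hN
    rw [sum_rainbowCount_face hcol]
    exact hN
  refine reducedHomologyMap_ne_zero_of_pairing q i j z hz w hw φ hφ ?_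
  have hval : z ≫ (intChainsMap i).f q ≫ φ = homOfValue A ((fun _ => (1 : ℤ) : ℕ → ℤ) : A) := by
    simp only [z, Preadditive.sum_comp, Preadditive.zsmul_comp, SSet.ι_chainComplexMap_f_assoc,
      map_singularSimplex, hφι]
    simp only [← map_zsmul, ← map_sum]
    congr 1
    have e (k) : Y.toSSetObjEquiv _ (singularSimplex Y (i.hom.comp (f k))) = i.hom.comp (f k) := rfl
    simp only [e, cnt]
    rw [hgerm]
    congr 1
    funext N
    have hS' (k : Fin (q + 2)) : ∀ x ∈ stdSimplex ℝ (Fin (q + 1)), ∃ l : Fin (q + 2),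
        pullColor col (i.hom.comp (f k)) x = l ∧ 0 < TupleChain.faceMap k x l := fun x hx => by
      rw [pullColor_of_mem _ _ hx]
      exact hS k ⟨x, hx⟩
    rw [Fin.sum_univ_succ, Finset.sum_eq_zero, add_zero]
    · obtain ⟨h1, h2⟩ := TupleChain.eval_rainbowSucc_face_zero (hS' 0) N
      simp only [Fin.val_zero, pow_zero, one_smul]
      exact h2.trans (TupleChain.eval_rainbow_iterate_sd h1 N)
    · intro k _
      exact smul_eq_zero_of_right _ (TupleChain.eval_rainbowSucc_face_succ k (hS' k.succ) N)
  rw [hval]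
  intro h
  rw [← map_zero (homOfValue A)] at h
  have := Filter.Germ.coe_eq.1 (homOfValue_injective A h)
  obtain ⟨N, hN⟩ := this.exists
  exact one_ne_zero hN

end NontrivialClass

/-! ### Signed distances and lines in a tree -/

namespace MergeTree

variable {X : Type u} [TopologicalSpace X] (T : MergeTree X)

/-- The tree distance of a point `x` from `v`, with the sign that tells if `x` lies in the branch
of `p` above `v`. -/
def signedDist (v p x : X) : ℝ :=
  open Classical in
  if T.ht v < T.meet x p then T.ht x + T.ht v - 2 * T.meet x v
  else -(T.ht x + T.ht v - 2 * T.meet x v)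

theorem ht_eq_of_signedDist_eq_zero {v p x : X} (hx : T.signedDist v p x = 0) :
    T.ht x = T.ht v := by
  have h1 := T.meet_le_left x v
  have h2 := T.meet_le_right x v
  rw [signedDist] at hx
  split_ifs at hx <;> linarith

/-- The sign can only switch at points whose distance from v is 0. -/
theorem continuous_signedDist {v p : X} (hp : T.meet v p = T.ht v) :
    Continuous (T.signedDist v p) := by
  have hm (y : X) : Continuous fun x => T.meet x y :=
    T.continuous_meet.comp (continuous_id.prodMk continuous_const)
  have hd : Continuous fun x => T.ht x + T.ht v - 2 * T.meet x v :=
    (T.continuous_ht.add continuous_const).sub (continuous_const.mul (hm v))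
  refine continuous_if (fun a ha => ?_) hd.continuousOn hd.neg.continuousOn
  have e : T.ht v = T.meet a p := frontier_lt_subset_eq continuous_const (hm p) ha
  -- If a were higher than v, nearby points would merge with a above v; one of them lies in the
  -- branch of p, so a would lie in it as well.
  have hle : T.ht a ≤ T.ht v := by
    by_contra! hlt
    have hnear : ∀ᶠ y in 𝓝 a, T.ht v < T.meet y a :=
      ((hm a).tendsto a).eventually (lt_mem_nhds (by rwa [T.meet_self]))
    obtain ⟨y, hy1, hy2⟩ :=
      ((mem_closure_iff_frequently.1 (frontier_subset_closure ha)).and_eventually hnear).exists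
    have := T.min_meet_le a y p
    rw [T.meet_comm a y, ← e] at this
    exact absurd (lt_min hy2 hy1) (not_lt.2 this)
  have hge := T.min_meet_le a p v
  rw [← e, T.meet_comm p v, hp, min_self] at hge
  have h1 := T.meet_le_left a v
  have h2 := T.meet_le_right a v
  linarith

/-- The line through `v` that ascends to `p` in the positive and to `q` in the negative
direction. -/
def line (v p q : X) (t : ℝ) : X :=
  open Classical in if 0 ≤ t then T.anc p (T.ht v + t) else T.anc q (T.ht v - t)

theorem continuous_line {v p q : X} (hpq : T.meet p q = T.ht v) : Continuous (T.line v p q) := by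
  refine Continuous.if_le ?_ ?_ continuous_const continuous_id ?_
  · exact T.continuous_anc.comp
      (continuous_const.prodMk (continuous_const.add continuous_id))
  · exact T.continuous_anc.comp
      (continuous_const.prodMk (continuous_const.sub continuous_id))
  · rintro t rfl
    rw [add_zero, sub_zero, ← hpq, T.anc_meet]

theorem ht_line {v p q : X} {r t : ℝ} (hp : T.ht v + r ≤ T.ht p) (hq : T.ht v + r ≤ T.ht q)
    (ht : |t| ≤ r) : T.ht (T.line v p q t) = T.ht v + |t| := by
  rw [line]
  split_ifs with h0
  · rw [T.ht_anc, abs_of_nonneg h0, min_eq_left]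
    rw [abs_of_nonneg h0] at ht
    linarith
  · rw [T.ht_anc, abs_of_neg (not_le.1 h0), sub_eq_add_neg, min_eq_left]
    rw [abs_of_neg (not_le.1 h0)] at ht
    linarith

theorem signedDist_line {v p q : X} {r t : ℝ} (hvp : T.meet v p = T.ht v)
    (hvq : T.meet v q = T.ht v) (hpq : T.meet p q = T.ht v) (hp : T.ht v + r ≤ T.ht p)
    (hq : T.ht v + r ≤ T.ht q) (ht : |t| ≤ r) : T.signedDist v p (T.line v p q t) = t := by
  have hh := T.ht_line hp hq ht
  rw [signedDist, hh, line]
  have ht' := abs_le.1 ht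
  rcases le_or_gt 0 t with h0 | h0
  · rw [if_pos h0, T.meet_anc, T.meet_anc, T.meet_self, T.meet_comm p v, hvp, abs_of_nonneg h0,
      min_eq_left (by linarith), min_eq_right (by linarith)]
    split_ifs with h1
    · ring
    · linarith
  · rw [if_neg (not_le.2 h0), T.meet_anc, T.meet_anc, T.meet_comm q p, hpq, T.meet_comm q v, hvq,
      abs_of_neg h0, min_eq_right (by linarith), if_neg (lt_irrefl _)]
    ring

end MergeTree

/-! ### The sphere in a flat around a low vertex -/

section

variable {q : ℕ} {V : Fin (q + 1) → Type u} {G : ∀ i, SimpleGraph (V i)} {h : ∀ i, V i → ℝ}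

/-- The sum of the distances of the coordinates of `t` from its first coordinate. -/
def spread (t : Fin (q + 2) → ℝ) : ℝ := ∑ i : Fin (q + 1), |t i.succ - t 0|

theorem abs_sub_le_spread (t : Fin (q + 2) → ℝ) (i : Fin (q + 1)) :
    |t i.succ - t 0| ≤ spread t :=
  Finset.single_le_sum (f := fun i : Fin (q + 1) => |t i.succ - t 0|) (fun _ _ => abs_nonneg _)
    (Finset.mem_univ i)

theorem sub_le_spread (t : Fin (q + 2) → ℝ) (i j : Fin (q + 2)) : t i - t j ≤ spread t := by
  rcases Fin.eq_zero_or_eq_succ i with rfl | ⟨i, rfl⟩ <;>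
  rcases Fin.eq_zero_or_eq_succ j with rfl | ⟨j, rfl⟩
  · rw [sub_self]
    exact Finset.sum_nonneg fun _ _ => abs_nonneg _
  · exact (neg_sub (t j.succ) (t 0) ▸ neg_le_abs _).trans (abs_sub_le_spread t j)
  · exact (le_abs_self _).trans (abs_sub_le_spread t i)
  · rcases eq_or_ne i j with rfl | hne
    · rw [sub_self]
      exact Finset.sum_nonneg fun _ _ => abs_nonneg _
    · have h1 : ∑ k ∈ {i, j}, |t (Fin.succ k) - t 0| ≤ spread t :=
        Finset.sum_le_sum_of_subset_of_nonneg (Finset.subset_univ _) fun _ _ _ => abs_nonneg _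
      rw [Finset.sum_pair hne] at h1
      have h2 := le_abs_self (t i.succ - t 0)
      have h3 := neg_abs_le (t j.succ - t 0)
      linarith

/-- Since t k = 0, each of the q + 2 coordinates is at most the spread, and they sum to 1. -/
theorem le_spread_of_mem_face {t : Fin (q + 2) → ℝ} (ht : t ∈ stdSimplex ℝ (Fin (q + 2)))
    {k : Fin (q + 2)} (hk : t k = 0) : 1 / ((q : ℝ) + 2) ≤ spread t := by
  have h1 : ∑ i, t i ≤ ∑ _i : Fin (q + 2), spread t := Finset.sum_le_sum fun i _ => by
    have := sub_le_spread t i k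
    rwa [hk, sub_zero] at this
  rw [ht.2, Finset.sum_const, Finset.card_univ, Fintype.card_fin, nsmul_eq_mul] at h1
  push_cast at h1
  rw [div_le_iff₀ (by positivity)]
  linarith

/-- In T the sphere is filled by a simplex through v, but v lies below the larger slab. The coloring
by the largest signed distance shows that no chain inside that slab can fill it. -/
theorem reducedHomologyMap_heightPreimageInclusion_ne_zero
    (T : ∀ i, MergeTree (Realization (G i))) (hT : ∀ i x, (T i).ht x = affineHeight (h i) x)
    {a b c d : ℝ} (hab : a ≤ b) (hIJ : Set.Icc a b ⊆ Set.Icc c d) :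
    reducedHomologyMap q (heightPreimageInclusion G h hIJ) ≠ 0 := by
  have hmem (I : Set ℝ) (x : ∀ i, Realization (G i)) :
      x ∈ heightPreimage G h I ↔ ∑ i, (T i).ht (x i) ∈ I := by
    simp only [hT]
    rfl
  have hca : c ≤ a := (hIJ ⟨le_rfl, hab⟩).1
  -- The bound puts v at total height at most c - 1, strictly below the larger slab.
  choose v hv hbranch using fun i => (T i).exists_branch ((c - 1) / (q + 1 : ℕ))
  have hvc : ∑ i, (T i).ht (v i) ≤ c - 1 := by
    refine (Finset.sum_le_sum fun i _ => hv i).trans_eq ?_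
    rw [Finset.sum_const, Finset.card_univ, Fintype.card_fin, nsmul_eq_mul]
    exact mul_div_cancel₀ _ (by positivity)
  obtain ⟨R, hR⟩ : ∃ R, R = a - ∑ i, (T i).ht (v i) := ⟨_, rfl⟩
  have hR0 : 0 < R := by linarith
  choose p p' hp hp' hvp hvp' hpp using fun i => hbranch i ((T i).ht (v i) + R)
  -- ε bounds the spread from below on the boundary of the simplex. There κ normalizes the spread to
  -- R, so the total height is exactly a; in the interior the maximum with ε avoids division by 0.
  let ε : ℝ := 1 / ((q : ℝ) + 2)
  have hε : 0 < ε := by positivity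
  let κ (t : Fin (q + 2) → ℝ) : ℝ := R / max (spread t) ε
  have hκ0 (t) : 0 < κ t := div_pos hR0 (hε.trans_le (le_max_right _ _))
  have hκ (t) (i : Fin (q + 1)) : |κ t * (t i.succ - t 0)| ≤ R := by
    have hpos : 0 < max (spread t) ε := hε.trans_le (le_max_right _ _)
    rw [abs_mul, abs_of_pos (hκ0 t)]
    simp only [κ]
    rw [div_mul_eq_mul_div, div_le_iff₀ hpos]
    exact mul_le_mul_of_nonneg_left ((abs_sub_le_spread t i).trans (le_max_left _ _)) hR0.le
  have hspread : Continuous (spread : (Fin (q + 2) → ℝ) → ℝ) := by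
    unfold spread
    fun_prop
  have hκc : Continuous κ := by
    refine continuous_const.div (hspread.max continuous_const) fun t => ?_
    exact (hε.trans_le (le_max_right _ _)).ne'
  let F₀ (t : Fin (q + 2) → ℝ) (i : Fin (q + 1)) : Realization (G i) :=
    (T i).line (v i) (p i) (p' i) (κ t * (t i.succ - t 0))
  have hF₀ : Continuous F₀ := continuous_pi fun i =>
    ((T i).continuous_line (hpp i)).comp
      (hκc.mul ((continuous_apply i.succ).sub (continuous_apply 0)))
  have hht (t i) : (T i).ht (F₀ t i) = (T i).ht (v i) + κ t * |t i.succ - t 0| := by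
    simp only [F₀]
    rw [(T i).ht_line (hp i) (hp' i) (hκ t i), abs_mul, abs_of_pos (hκ0 t)]
  have hdist (t i) : (T i).signedDist (v i) (p i) (F₀ t i) = κ t * (t i.succ - t 0) :=
    (T i).signedDist_line (hvp i) (hvp' i) (hpp i) (hp i) (hp' i) (hκ t i)
  have hface (k : Fin (q + 2)) (t : stdSimplex ℝ (Fin (q + 1))) :
      F₀ (stdFace k t) ∈ heightPreimage G h (Set.Icc a b) := by
    have hs : ε ≤ spread (stdFace k t) := le_spread_of_mem_face (stdFace k t).2
      (TupleChain.faceMap_apply_self k t)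
    rw [hmem]
    have : ∑ i, (T i).ht (F₀ (stdFace k t) i) = a := by
      simp only [hht]
      rw [Finset.sum_add_distrib, ← Finset.mul_sum]
      change _ + κ (stdFace k t) * spread (stdFace k t) = a
      simp only [κ]
      rw [max_eq_left hs, div_mul_cancel₀ _ (hε.trans_le hs).ne']
      linarith
    rw [this]
    exact ⟨le_rfl, hab⟩
  let Y := TopCat.of (heightPreimage G h (Set.Icc c d))
  let W := TopCat.of (∀ i, Realization (G i))
  let j : TopCat.of (heightPreimage G h (Set.Icc a b)) ⟶ W :=
    TopCat.ofHom ⟨Subtype.val, continuous_subtype_val⟩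
  have : Mono j := (TopCat.mono_iff_injective j).2 Subtype.val_injective
  -- Weights of the colors: 0 for color 0 and the signed distance in tree i for color i + 1. A point
  -- receives a color of largest weight.
  let w (y : Y) : Fin (q + 2) → ℝ := Fin.cons 0 fun i => (T i).signedDist (v i) (p i) (y.1 i)
  have hw (l : Fin (q + 2)) : Continuous fun y => w y l := by
    rcases Fin.eq_zero_or_eq_succ l with rfl | ⟨i, rfl⟩
    · exact continuous_const
    · exact ((T i).continuous_signedDist (hvp i)).comp
        ((continuous_apply i).comp continuous_subtype_val)
  choose col hcol using fun y => Finite.exists_max (w y)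
  refine reducedHomologyMap_ne_zero_of_coloring (heightPreimageInclusion G h hIJ) j
    ⟨fun t => F₀ t, hF₀.comp continuous_subtype_val⟩
    (fun k => ⟨fun t => ⟨F₀ (stdFace k t), hface k t⟩,
      (hF₀.comp (continuous_subtype_val.comp (stdFace k).continuous)).subtype_mk _⟩)
    (fun k => rfl) (fun y => (col y : ℕ)) (fun y => (col y).2)
    (C := fun k => {y | ∀ l, w y l ≤ w y k}) (fun k => ?_) (fun y k hk => ?_) ?_ fun k t => ?_
  · simp only [Set.ofPred_forall]
    exact isClosed_iInter fun l => isClosed_le (hw l) (hw k)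
  · have e : col y = k := Fin.ext hk
    exact e ▸ hcol y
  · refine Set.eq_empty_of_forall_notMem fun y hy => ?_
    have hy' (k l) : w y l ≤ w y k := Set.mem_iInter.1 hy k l
    -- If all colors tie, every signed distance equals the weight 0 of color 0.
    have h0 (i) : (T i).ht (y.1 i) = (T i).ht (v i) :=
      (T i).ht_eq_of_signedDist_eq_zero (p := p i) (le_antisymm (hy' 0 i.succ) (hy' i.succ 0))
    have := ((hmem _ _).1 y.2).1
    simp only [h0] at this
    linarith
  · set y : Y := heightPreimageInclusion G h hIJ ⟨F₀ (stdFace k t), hface k t⟩ with hy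
    refine ⟨col y, rfl, ?_⟩
    -- On the flat the weights are a positive multiple of t l - t 0, so the color belongs to a
    -- largest barycentric coordinate. That coordinate is positive, which is the Sperner condition.
    have hwy (l) : w y l = κ (stdFace k t) * (stdFace k t l - stdFace k t 0) := by
      rcases Fin.eq_zero_or_eq_succ l with rfl | ⟨i, rfl⟩
      · rw [sub_self, mul_zero]
        rfl
      · exact hdist _ i
    have hmax (l) : stdFace k t l ≤ stdFace k t (col y) := by
      have := hcol y l
      rw [hwy, hwy] at this
      have := le_of_mul_le_mul_left this (hκ0 _)
      linarith
    by_contra! hle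
    have h1 : ∑ l, stdFace k t l ≤ 0 := Finset.sum_nonpos fun l _ => (hmax l).trans hle
    rw [stdSimplex.sum_eq_one] at h1
    linarith

end

end

theorem mainTheorem6 (m : ℕ) (hm : 1 ≤ m) (V : Fin m → Type u)
    (G : ∀ i, SimpleGraph (V i)) (h : ∀ i, V i → ℝ)
    (htree : ∀ i, (G i).IsTree)
    (hfin : ∀ i v, ((G i).neighborSet v).Finite)
    (hdiscrete : ∀ i (a b : ℝ), (Set.range (h i) ∩ Set.Icc a b).Finite)
    (hend : ∀ i, HasUniqueDescendingEnd (G i) (h i))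
    (hdeg : ∀ i v, 3 ≤ ((G i).neighborSet v).encard) :
    (∀ a b : ℝ, a ≤ b →
      IsHomotopyConnected ((m : ℤ) - 2) (heightPreimage G h (Set.Icc a b))) ∧
    (∀ a b c d : ℝ, a ≤ b → ∀ hIJ : Set.Icc a b ⊆ Set.Icc c d,
      reducedHomologyMap (m - 1) (heightPreimageInclusion G h hIJ) ≠ 0) := by
  have P (i : Fin m) : ParentData (G i) (h i) := Classical.choice
    (exists_parentData (htree i) (hfin i) (hdiscrete i) (hend i) (hdeg i))
  have hne (i : Fin m) : Nonempty (V i) := (htree i).connected.nonempty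
  let T (i : Fin m) : MergeTree (Realization (G i)) := (P i).mergeTree
  have hT (i x) : (T i).ht x = affineHeight (h i) x := ((P i).affineHeight_eq x).symm
  refine ⟨fun a b hab => isHomotopyConnected_heightPreimage hm T hT hab, ?_⟩
  obtain ⟨q, rfl⟩ := Nat.exists_eq_succ_of_ne_zero (by omega : m ≠ 0)
  intro a b c d hab hIJ
  exact reducedHomologyMap_heightPreimageInclusion_ne_zero T hT hab hIJ
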